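/- **Theorem 5.2.** Let $M$ be a smooth $n$-dimensional manifold with a Riemannian metric $g$ and an almost contact metric structure $(\phi,\xi,\eta,g)$: $\phi$ is a smooth $(1,1)$-tensor field, $\xi$ a smooth vector field and $\eta$ a smooth 1-form such that, for all vector fields $X,Y$, $$\phi^2X=-X+\eta(X)\xi,\quad \eta(\xi)=1,\quad \eta\circ\phi=0,\quad \phi\xi=0,$$ $$g(\phi X,\phi Y)=g(X,Y)-\eta(X)\eta(Y),\quad g(X,\phi Y)=-g(\phi X,Y),\quad g(X,\xi)=\eta(X).$$ Let $\alpha\in\mathbb R$ and suppose that $M$ is $\alpha$-cosymplectic: with $\Phi(X,Y)=g(\phi X,Y)$, $$d\eta=0,\qquad d\Phi=2\alpha\,\eta\wedge\Phi,$$ and the structure is normal, i.e. (for $d\eta(X,Y)=X\eta(Y)-Y\eta(X)-\eta([X,Y])$) $$[\phi X,\phi Y]-\phi[\phi X,Y]-\phi[X,\phi Y]+\phi^2[X,Y]+d\eta(X,Y)\,\xi=0 .$$ Let $\nabla$ be the Levi-Civita connection of $g$, with scalar curvature $r$, and let $\tilde\nabla$ be a quarter-symmetric metric connection, i.e. a linear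 connection with $\tilde\nabla g=0$ and torsion $T(X,Y)=\eta(Y)\phi X-\eta(X)\phi Y$. Let $\tilde R(X,Y)Z=\tilde\nabla_X\tilde\nabla_YZ-\tilde\nabla_Y\tilde\nabla_XZ-\tilde\nabla_{[X,Y]}Z$ be its curvature, $\tilde S^\ast(Y,Z)=\tfrac12\operatorname{Tr}\{X\mapsto\tilde R(Y,\phi Z)\phi X\}$ its $\ast$-Ricci tensor, $\tilde r^\ast=\operatorname{Tr}_g\tilde S^\ast$ its $\ast$-scalar curvature, and $(\tilde{\mathcal L}_\xi g)(Y,Z)=g(\tilde\nabla_Y\xi,Z)+g(Y,\tilde\nabla_Z\xi)$. Suppose that $M$ admits a $\ast$-$\eta$-Yamabe soliton with respect to $\tilde\nabla$, i.e. a $\ast$-$\eta$-Ricci-Yamabe soliton $$\tilde{\mathcal L}_\xi g+2\rho\,\tilde S^\ast+[2\Lambda-q\,\tilde r^\ast]\,g+2\mu\,\eta\otimes\eta=0$$ with $\rho=0$, $q=1$ and real constants $\Lambda,\mu$. If $\xi=\operatorname{grad} f$ for a smooth function $f:M\to\mathbb R$, then at every point of $M$ the Laplacian $\Delta f=\operatorname{div}(\operatorname{grad}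 f)=\operatorname{Tr}\{X\mapsto\nabla_X\operatorname{grad} f\}$ satisfies $$\Delta f=-n\Big[\Lambda-\frac r2-\frac{\alpha^2(n-1)^2}{2}\Big]-\mu .$$ -/

import Mathlib

open scoped Manifold ContDiff Bundle
open Bundle

noncomputable section

namespace StarYamabe

/-! Everything below lives on a smooth manifold `M` of dimension `n` (modelled on `ℝⁿ`, without
boundary), whose tangent bundle carries a smooth Riemannian metric `g = inner ℝ`. -/

variable {n : ℕ} {M : Type*} [TopologicalSpace M] [ChartedSpace (EuclideanSpace ℝ (Fin n)) M]

/-- A (not necessarily smooth) vector field on `M`. -/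
abbrev VField (n : ℕ) (M : Type*) [TopologicalSpace M]
    [ChartedSpace (EuclideanSpace ℝ (Fin n)) M] : Type _ :=
  (x : M) → TangentSpace (𝓡 n) x

/-- A linear connection on the tangent bundle of `M`; `D Y x (X x)` is `(D_X Y)(x)`. -/
abbrev LinearConnection (n : ℕ) (M : Type*) [TopologicalSpace M]
    [ChartedSpace (EuclideanSpace ℝ (Fin n)) M] [IsManifold (𝓡 n) ∞ M] : Type _ :=
  CovariantDerivative (𝓡 n) (EuclideanSpace ℝ (Fin n)) (fun x : M => TangentSpace (𝓡 n) x)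

section Forms

/-- `X` is a smooth vector field, i.e. a smooth section of the tangent bundle. -/
def IsSmoothField [IsManifold (𝓡 n) ∞ M] (X : VField n M) : Prop :=
  ContMDiff (𝓡 n) (𝓡 n).tangent ∞ (fun x => (⟨x, X x⟩ : TangentBundle (𝓡 n) M))

/-- The derivative `X(u)` of a function `u` along a vector field `X`. -/
def dirDeriv (X : VField n M) (u : M → ℝ) (x : M) : ℝ :=
  mvfderiv (𝓡 n) u x (X x)

/-- The exterior derivative of a 1-form evaluated on vector fields,
`dθ(X, Y) = X θ(Y) - Y θ(X) - θ([X, Y])`. -/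
def extDerivOne (θ : (x : M) → TangentSpace (𝓡 n) x → ℝ) (X Y : VField n M) (x : M) : ℝ :=
  dirDeriv X (fun y => θ y (Y y)) x - dirDeriv Y (fun y => θ y (X y)) x
    - θ x (VectorField.mlieBracket (𝓡 n) X Y x)

/-- The exterior derivative of a 2-form evaluated on vector fields, `dΩ(X, Y, Z)` being the cyclic
sum of `X Ω(Y, Z) - Ω([X, Y], Z)`. -/
def extDerivTwo (Ω : (x : M) → TangentSpace (𝓡 n) x → TangentSpace (𝓡 n) x → ℝ)
    (X Y Z : VField n M) (x : M) : ℝ :=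
  dirDeriv X (fun y => Ω y (Y y) (Z y)) x
    + dirDeriv Y (fun y => Ω y (Z y) (X y)) x
    + dirDeriv Z (fun y => Ω y (X y) (Y y)) x
    - Ω x (VectorField.mlieBracket (𝓡 n) X Y x) (Z x)
    - Ω x (VectorField.mlieBracket (𝓡 n) Y Z x) (X x)
    - Ω x (VectorField.mlieBracket (𝓡 n) Z X x) (Y x)

/-- The wedge product `θ ∧ Ω` of a 1-form and a 2-form evaluated on vector fields, normalized as
`extDerivTwo` is (so that `d(θ ∧ θ') = dθ ∧ θ' - θ ∧ dθ'`). -/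
def wedgeOneTwo (θ : (x : M) → TangentSpace (𝓡 n) x → ℝ)
    (Ω : (x : M) → TangentSpace (𝓡 n) x → TangentSpace (𝓡 n) x → ℝ)
    (X Y Z : VField n M) (x : M) : ℝ :=
  θ x (X x) * Ω x (Y x) (Z x) + θ x (Y x) * Ω x (Z x) (X x) + θ x (Z x) * Ω x (X x) (Y x)

end Forms

variable [IsManifold (𝓡 n) ∞ M] [RiemannianBundle (fun x : M => TangentSpace (𝓡 n) x)]

section Curvature

/-- `D_X Y`. -/
def cov (D : LinearConnection n M) (X Y : VField n M) : VField n M :=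
  fun x => D Y x (X x)

/-- The curvature `R(X, Y)Z = D_X D_Y Z - D_Y D_X Z - D_[X,Y] Z` on vector fields. -/
def curvField (D : LinearConnection n M) (X Y Z : VField n M) : VField n M :=
  cov D X (cov D Y Z) - cov D Y (cov D X Z) - cov D (VectorField.mlieBracket (𝓡 n) X Y) Z

/-- The curvature tensor `R(u, v)w` at `x`. The right side is tensorial, so any extension of the
tangent vectors to smooth vector fields near `x` gives the same value. -/
def curv (D : LinearConnection n M) (x : M) (u v w : TangentSpace (𝓡 n) x) :
    TangentSpace (𝓡 n) x :=
  curvField D (FiberBundle.extend (EuclideanSpace ℝ (Fin n)) u)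
    (FiberBundle.extend (EuclideanSpace ℝ (Fin n)) v)
    (FiberBundle.extend (EuclideanSpace ℝ (Fin n)) w) x

instance (x : M) : FiniteDimensional ℝ (TangentSpace (𝓡 n) x) :=
  inferInstanceAs (FiniteDimensional ℝ (EuclideanSpace ℝ (Fin n)))

/-- An orthonormal basis `e_i` of `T_x M`. -/
def onb (x : M) := stdOrthonormalBasis ℝ (TangentSpace (𝓡 n) x)

/-- The metric trace of a bilinear form on `T_x M`. -/
def metricTrace (x : M) (B : TangentSpace (𝓡 n) x → TangentSpace (𝓡 n) x → ℝ) : ℝ :=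
  ∑ i, B (onb x i) (onb x i)

/-- The Ricci tensor `S(v, w) = Σ g(R(e_i, v)w, e_i)`. -/
def ricci (D : LinearConnection n M) (x : M) (v w : TangentSpace (𝓡 n) x) : ℝ :=
  metricTrace x (fun a b => inner ℝ (curv D x a v w) b)

/-- The scalar curvature `r = Tr S`. -/
def scalarCurv (D : LinearConnection n M) (x : M) : ℝ :=
  metricTrace x (ricci D x)

/-- The `∗`-Ricci tensor `S∗(v, w) = ½ Tr (u ↦ R(v, φ w) φ u)` of the connection `D`. -/
def starRicci (D : LinearConnection n M)
    (φ : (x : M) → TangentSpace (𝓡 n) x →L[ℝ] TangentSpace (𝓡 n) x)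
    (x : M) (v w : TangentSpace (𝓡 n) x) : ℝ :=
  (1 / 2) * metricTrace x (fun a b => inner ℝ (curv D x v (φ x w) (φ x a)) b)

/-- The `∗`-scalar curvature `r∗ = Tr S∗` of the connection `D`. -/
def starScalarCurv (D : LinearConnection n M)
    (φ : (x : M) → TangentSpace (𝓡 n) x →L[ℝ] TangentSpace (𝓡 n) x) (x : M) : ℝ :=
  metricTrace x (starRicci D φ x)

/-- The Lie derivative of the metric with respect to the connection `D`,
`(L_V g)(v, w) = g(D_v V, w) + g(v, D_w V)`. -/
def lieMetric (D : LinearConnection n M) (V : VField n M) (x : M)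
    (v w : TangentSpace (𝓡 n) x) : ℝ :=
  inner ℝ (D V x v) w + inner ℝ v (D V x w)

/-- The gradient of a function: `g(grad f, v) = df(v)`. -/
def grad (f : M → ℝ) : VField n M :=
  fun x =>
    haveI : CompleteSpace (TangentSpace (𝓡 n) x) := FiniteDimensional.complete ℝ _
    (InnerProductSpace.toDual ℝ (TangentSpace (𝓡 n) x)).symm (mvfderiv (𝓡 n) f x)

/-- The divergence `Σ g(D_{e_i} V, e_i)`. -/
def divergence (D : LinearConnection n M) (V : VField n M) (x : M) : ℝ :=
  metricTrace x (fun a b => inner ℝ (D V x a) b)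

/-- The Laplacian `Δ f = div (grad f)`, the trace of the Hessian when `D` is the Levi-Civita
connection. -/
def laplacian (D : LinearConnection n M) (f : M → ℝ) (x : M) : ℝ :=
  divergence D (grad f) x

end Curvature

section Structures

/-- An almost contact metric structure `(φ, ξ, η)` on the Riemannian manifold `M`. -/
structure AlmostContactMetric (n : ℕ) (M : Type*) [TopologicalSpace M]
    [ChartedSpace (EuclideanSpace ℝ (Fin n)) M] [IsManifold (𝓡 n) ∞ M]
    [RiemannianBundle (fun x : M => TangentSpace (𝓡 n) x)] where
  /-- the (1,1)-tensor field -/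
  φ : (x : M) → TangentSpace (𝓡 n) x →L[ℝ] TangentSpace (𝓡 n) x
  /-- the characteristic vector field -/
  ξ : VField n M
  /-- the 1-form -/
  η : (x : M) → TangentSpace (𝓡 n) x →L[ℝ] ℝ
  smooth_φ : ∀ X : VField n M, IsSmoothField X → IsSmoothField (fun x => φ x (X x))
  smooth_ξ : IsSmoothField ξ
  smooth_η : ∀ X : VField n M, IsSmoothField X →
    ContMDiff (𝓡 n) 𝓘(ℝ, ℝ) ∞ (fun x => η x (X x))
  φ_φ : ∀ x v, φ x (φ x v) = -v + η x v • ξ x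
  η_ξ : ∀ x, η x (ξ x) = 1
  η_φ : ∀ x v, η x (φ x v) = 0
  φ_ξ : ∀ x, φ x (ξ x) = 0
  compat : ∀ x v w, inner ℝ (φ x v) (φ x w) = inner ℝ v w - η x v * η x w
  skew : ∀ x v w, inner ℝ v (φ x w) = -inner ℝ (φ x v) w
  inner_ξ : ∀ x v, inner ℝ v (ξ x) = η x v

/-- The fundamental 2-form `Φ(X, Y) = g(φ X, Y)`. -/
def AlmostContactMetric.Phi (A : AlmostContactMetric n M) (x : M) (v w : TangentSpace (𝓡 n) x) :
    ℝ :=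
  inner ℝ (A.φ x v) w

/-- The Nijenhuis torsion
`N(X, Y) = [φX, φY] - φ[φX, Y] - φ[X, φY] + φ²[X, Y] + (X η(Y) - Y η(X) - η([X, Y])) ξ`; the last
bracket is what is written `2dη(X, Y)` when `d` is normalized with the factor `1/2`. -/
def AlmostContactMetric.nijenhuis (A : AlmostContactMetric n M) (X Y : VField n M) : VField n M :=
  fun x =>
    VectorField.mlieBracket (𝓡 n) (fun y => A.φ y (X y)) (fun y => A.φ y (Y y)) x
      - A.φ x (VectorField.mlieBracket (𝓡 n) (fun y => A.φ y (X y)) Y x)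
      - A.φ x (VectorField.mlieBracket (𝓡 n) X (fun y => A.φ y (Y y)) x)
      + A.φ x (A.φ x (VectorField.mlieBracket (𝓡 n) X Y x))
      + extDerivOne (fun y => A.η y) X Y x • A.ξ x

/-- The structure is `α`-cosymplectic: `dη = 0`, `dΦ = 2α η ∧ Φ`, and normal. -/
structure AlmostContactMetric.IsAlphaCosymplectic (A : AlmostContactMetric n M) (α : ℝ) :
    Prop where
  d_η : ∀ X Y : VField n M, IsSmoothField X → IsSmoothField Y → ∀ x,
    extDerivOne (fun y => A.η y) X Y x = 0
  d_Φ : ∀ X Y Z : VField n M, IsSmoothField X → IsSmoothField Y → IsSmoothField Z → ∀ x,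
    extDerivTwo A.Phi X Y Z x = 2 * α * wedgeOneTwo (fun y => A.η y) A.Phi X Y Z x
  normal : ∀ X Y : VField n M, IsSmoothField X → IsSmoothField Y → ∀ x,
    A.nijenhuis X Y x = 0

variable [IsContMDiffRiemannianBundle (𝓡 n) ∞ (EuclideanSpace ℝ (Fin n))
  (fun x : M => TangentSpace (𝓡 n) x)]

theorem riemannianBundle_one :
    IsContMDiffRiemannianBundle (𝓡 n) 1 (EuclideanSpace ℝ (Fin n))
      (fun x : M => TangentSpace (𝓡 n) x) :=
  IsContMDiffRiemannianBundle.of_le (n := ∞) (by exact_mod_cast le_top)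

/-- The connection `D` is metric, `D g = 0`. -/
def IsMetric (D : LinearConnection n M) : Prop :=
  haveI := riemannianBundle_one (n := n) (M := M)
  D.IsMetricCompatible

/-- `D` is the Levi-Civita connection: smooth, metric and torsion free. -/
structure IsLeviCivita (D : LinearConnection n M) : Prop where
  smooth : ∀ X Y : VField n M, IsSmoothField X → IsSmoothField Y → IsSmoothField (cov D X Y)
  metric : IsMetric D
  torsion_free : ∀ (x : M) (v w : TangentSpace (𝓡 n) x), D.torsion x v w = 0

/-- `D` is a quarter-symmetric metric connection: smooth, metric, and of torsion
`T(X, Y) = η(Y) φX - η(X) φY`. -/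
structure AlmostContactMetric.IsQuarterSymmetricMetric (A : AlmostContactMetric n M)
    (D : LinearConnection n M) : Prop where
  smooth : ∀ X Y : VField n M, IsSmoothField X → IsSmoothField Y → IsSmoothField (cov D X Y)
  metric : IsMetric D
  torsion_eq : ∀ (x : M) (v w : TangentSpace (𝓡 n) x),
    D.torsion x v w = A.η x w • A.φ x v - A.η x v • A.φ x w

end Structures

/-- `(g, ξ, Λ, μ, ρ, q)` is a `∗`-`η`-Ricci-Yamabe soliton with respect to the connection `D`:
`L_ξ g + 2ρ S∗ + [2Λ - q r∗] g + 2μ η ⊗ η = 0`, where `L`, `S∗` and `r∗` are those of `D`. -/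
def AlmostContactMetric.IsStarEtaRicciYamabeSoliton (A : AlmostContactMetric n M)
    (D : LinearConnection n M) (ρ q Λ μ : ℝ) : Prop :=
  ∀ (x : M) (v w : TangentSpace (𝓡 n) x),
    lieMetric D A.ξ x v w + 2 * ρ * starRicci D A.φ x v w
      + (2 * Λ - q * starScalarCurv D A.φ x) * inner ℝ v w + 2 * μ * (A.η x v * A.η x w) = 0

/-- A `∗`-`η`-Yamabe soliton is a `∗`-`η`-Ricci-Yamabe soliton of type `ρ = 0`, `q = 1`. -/
def AlmostContactMetric.IsStarEtaYamabeSoliton (A : AlmostContactMetric n M)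
    (D : LinearConnection n M) (Λ μ : ℝ) : Prop :=
  A.IsStarEtaRicciYamabeSoliton D 0 1 Λ μ

end StarYamabe

end

/-!
Since `ξ = grad f` and `φ ξ = 0`, the trace of the soliton equation is
`2 Δf + n (2Λ - r̃∗) + 2μ = 0`, so all that is to be shown is `r̃∗ = r + α² (n - 1)²`.

*The structure equations.* On one tangent space, `h = ∇ξ` and `P = ∇φ` satisfy linear equations:
derivatives of the algebraic relations between `φ, ξ, η, g`, together with `dη = 0`,
`dΦ = 2α η ∧ Φ` and normality. These have at most one solution
(`ContactAlgebra.eq_zero_of_cosymplectic`), hence `∇_X ξ = α (X - η(X) ξ)` and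
`(∇_X φ) Y = α (g(φX, Y) ξ - η(Y) φX)` (`ContactAlgebra.nabla_formulas`).

*The `∗`-scalar curvature of `∇`.* Differentiating once more yields the commutator of the
curvature `R` with `φ` (`curvatureTensor_φ`). It says that
`W(X, Y)Z = R(X, Y)Z + α² (g(Y, Z) X - g(X, Z) Y)` commutes with `φ`. Like the curvature of a Kähler
manifold, such a tensor has equal Ricci and `∗`-Ricci tensors, by the first Bianchi identity
(`ContactAlgebra.star_trace_of_commute`). Thus `S∗ = S + α² ((n - 2) g + η ⊗ η)`, and the trace is
`r∗ = r + α² (n - 1)²` (`starScalarCurv_leviCivita`).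

*The quarter-symmetric connection.* A metric connection is determined by its torsion, so
`D = ∇ - η ⊗ φ`. As `dη = 0`, its curvature is `R(X, Y)Z + η(X) (∇_Y φ) Z - η(Y) (∇_X φ) Z`, and the
extra terms do not contribute to the `∗`-Ricci tensor (`starRicci_quarterSymmetric`).

Curvature differentiates twice, so it is tensorial on smooth fields only and `TensorialAt`, which
tests differentiable fields, does not apply to it. `SmoothTensorialAt` is the smooth version; bump
functions extend tangent vectors to globally smooth fields, on which the hypotheses can be used.
-/

noncomputable section

namespace StarYamabe

open scoped Topology RealInnerProductSpace
open VectorField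

/-! ### Linear algebra on one tangent space -/

section

/-- The Koszul argument: a trilinear form that is symmetric in its first two and skew in its last
two arguments vanishes. -/
theorem eq_zero_of_symm_of_skew {V : Type*} {t : V → V → V → ℝ} (hs : ∀ x y z, t x y z = t y x z)
    (ha : ∀ x y z, t x y z = -t x z y) (x y z : V) : t x y z = 0 := by
  linarith [hs x y z, ha y x z, hs y z x, ha z y x, hs z x y, ha x z y]

section LinearAlgebra

variable {V : Type*} [NormedAddCommGroup V] [InnerProductSpace ℝ V]

/-- The algebra of an almost contact metric structure on a single tangent space `V`. The
compatibility `⟪φ v, φ w⟫ = ⟪v, w⟫ - η v η w` is left out, as it follows from the rest. -/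
structure ContactAlgebra (φ : V →ₗ[ℝ] V) (ξ : V) (η : V →ₗ[ℝ] ℝ) : Prop where
  φ_φ : ∀ v, φ (φ v) = -v + η v • ξ
  η_ξ : η ξ = 1
  η_φ : ∀ v, η (φ v) = 0
  φ_ξ : φ ξ = 0
  skew : ∀ v w, ⟪v, φ w⟫ = -⟪φ v, w⟫
  inner_ξ : ∀ v, ⟪v, ξ⟫ = η v

namespace ContactAlgebra

variable {φ : V →ₗ[ℝ] V} {ξ : V} {η : V →ₗ[ℝ] ℝ} (C : ContactAlgebra φ ξ η)
include C

theorem inner_φ_φ (v w : V) : ⟪φ v, φ w⟫ = ⟪v, w⟫ - η v * η w := by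
  rw [C.skew, C.φ_φ, inner_add_left, inner_neg_left, inner_smul_left, real_inner_comm w ξ,
    C.inner_ξ]
  simp only [conj_trivial]
  ring

theorem inner_ξ_left (v : V) : ⟪ξ, v⟫ = η v := by rw [real_inner_comm, C.inner_ξ]

theorem inner_φ_left (v w : V) : ⟪φ v, w⟫ = -⟪φ w, v⟫ := by
  rw [real_inner_comm, C.skew]

/-- A tensor with the algebraic symmetries of the difference of two quarter-symmetric metric
connections from a torsion free one is determined by them. -/
theorem eq_neg_smul_of_skew {H : V → V → V} (hskew : ∀ v y z, ⟪H v y, z⟫ + ⟪y, H v z⟫ = 0)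
    (htor : ∀ v y, H v y - H y v = η y • φ v - η v • φ y) (v y : V) :
    H v y = -(η v • φ y) := by
  have h := eq_zero_of_symm_of_skew (t := fun v y z => ⟪H v y + η v • φ y, z⟫) ?_ ?_ v y
  · rw [eq_neg_iff_add_eq_zero]
    exact inner_self_eq_zero (𝕜 := ℝ).1 (h _)
  · intro x y z
    have : H x y + η x • φ y = H y x + η y • φ x := by
      rw [← sub_eq_zero, ← sub_eq_zero.2 (htor x y)]; abel
    simp only [this]
  · intro x y z
    have h1 := hskew x y z
    have h2 := C.inner_φ_left y z
    simp only [inner_add_left, inner_smul_left, conj_trivial]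
    have h3 := real_inner_comm y (H x z)
    rw [h2]
    linarith

/-- The uniqueness part of the formula for `∇φ`: a tensor `Q` with the symmetries of `∇φ` on an
almost contact metric manifold with `dη = 0`, `dΦ = 0` and vanishing Nijenhuis torsion is zero,
and so is the tensor `k`, in the role of `∇ξ`. -/
theorem eq_zero_of_cosymplectic {Q : V →ₗ[ℝ] V →ₗ[ℝ] V} {k : V →ₗ[ℝ] V}
    (hQ : ∀ x y z, ⟪Q x y, z⟫ = -⟪y, Q x z⟫)
    (hQφ : ∀ x y, Q x (φ y) + φ (Q x y) = ⟪k x, y⟫ • ξ + η y • k x)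
    (hQξ : ∀ x, Q x ξ = -φ (k x))
    (hk : ∀ x y, ⟪k x, y⟫ = ⟪k y, x⟫) (hkξ : ∀ x, η (k x) = 0)
    (hcyc : ∀ x y z, ⟪Q x y, z⟫ + ⟪Q y z, x⟫ + ⟪Q z x, y⟫ = 0)
    (hN : ∀ x y, Q (φ x) y - Q (φ y) x + φ (Q y x) - φ (Q x y) = 0) :
    (∀ x, k x = 0) ∧ ∀ x y, Q x y = 0 := by
  have hφφk (x) : φ (φ (k x)) = -k x := by rw [C.φ_φ, hkξ]; simp
  -- The case `y = ξ` of the Nijenhuis condition gives `φ k φ = 0`.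
  have h1 (x z) : ⟪Q ξ x, φ z⟫ = -⟪φ (k (φ x)), z⟫ - ⟪k x, z⟫ := by
    have := congrArg (fun v => ⟪v, z⟫) (hN x ξ)
    simp only [C.φ_ξ, hQξ, map_zero, LinearMap.zero_apply, map_neg, hφφk, inner_add_left,
      inner_sub_left, inner_neg_left, inner_zero_left, neg_neg] at this
    have h2 := C.skew (Q ξ x) z
    linarith
  have h2 (x z) : ⟪φ (k (φ x)), z⟫ = 0 := by
    have e := hcyc ξ x (φ z)
    have e1 : ⟪Q x (φ z), ξ⟫ = ⟪k x, z⟫ := by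
      rw [hQ, hQξ, inner_neg_right, neg_neg, C.inner_φ_φ, hkξ, real_inner_comm]; simp
    have e2 : ⟪Q (φ z) ξ, x⟫ = -⟪φ (k (φ x)), z⟫ := by
      rw [hQξ, inner_neg_left, ← neg_eq_iff_eq_neg.2 (C.skew (k (φ z)) x), hk,
        C.skew]
      ring_nf
    rw [h1, e1, e2] at e
    linarith
  have hkφ (x) : k (φ x) = 0 := by
    have := hφφk (φ x)
    rw [inner_self_eq_zero (𝕜 := ℝ).1 (h2 x _), map_zero] at this
    simpa using this.symm
  have hkξ' : k ξ = 0 := by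
    refine inner_self_eq_zero (𝕜 := ℝ).1 ?_
    rw [hk, C.inner_ξ, hkξ]
  have hk0 (x) : k x = 0 := by
    have : x = -φ (φ x) + η x • ξ := by rw [C.φ_φ]; abel
    rw [this, map_add, map_neg, hkφ, map_smul, hkξ']; simp
  refine ⟨hk0, ?_⟩
  have hξ2 (x) : Q x ξ = 0 := by rw [hQξ, hk0]; simp
  have hξ3 (x y) : ⟪Q x y, ξ⟫ = 0 := by rw [hQ, hξ2]; simp
  have hη (x y) : η (Q x y) = 0 := by rw [← C.inner_ξ, hξ3]
  have hφ2 (x y) : Q x (φ y) = -φ (Q x y) := by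
    rw [eq_neg_iff_add_eq_zero, hQφ, hk0]; simp
  -- `(x, y, z) ↦ ⟪Q (φ x) y - φ (Q x y), z⟫` is symmetric in `x, y` and skew in `y, z`.
  have hφ1 (x y) : Q (φ x) y = φ (Q x y) := by
    have h := eq_zero_of_symm_of_skew (t := fun x y z => ⟪Q (φ x) y - φ (Q x y), z⟫) ?_ ?_ x y
    · exact sub_eq_zero.1 (inner_self_eq_zero (𝕜 := ℝ).1 (h _))
    · intro x y z
      have : Q (φ x) y - φ (Q x y) = Q (φ y) x - φ (Q y x) := by
        rw [← sub_eq_zero, ← hN x y]; abel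
      simp only [this]
    · intro x y z
      have e1 := hQ (φ x) y z
      have e2 := C.skew (Q x y) z
      have e3 := hQ x y (φ z)
      rw [hφ2, inner_neg_right] at e3
      have e4 := real_inner_comm y (φ (Q x z))
      have e5 := real_inner_comm y (Q (φ x) z)
      simp only [inner_sub_left]
      linarith
  have hq (z x y) : ⟪Q z x, y⟫ = 0 := by
    have e := hcyc (φ x) (φ y) z
    have e0 := hcyc x y z
    rw [hφ1, hφ2, map_neg, C.φ_φ, hη, hφ1, C.inner_φ_φ, hη] at e
    simp only [hφ2, inner_neg_left, C.inner_φ_φ, hη, zero_smul, add_zero, neg_neg, zero_mul,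
      sub_zero] at e
    linarith
  exact fun x y => inner_self_eq_zero (𝕜 := ℝ).1 (hq x y _)

/-- On a tangent space of an `α`-cosymplectic manifold, the algebraic consequences of the structure
equations determine `h = ∇ξ` and `P = ∇φ`. -/
theorem nabla_formulas {P : V →ₗ[ℝ] V →ₗ[ℝ] V} {h : V →ₗ[ℝ] V} {α : ℝ}
    (hP : ∀ x y z, ⟪P x y, z⟫ = -⟪y, P x z⟫)
    (hPφ : ∀ x y, P x (φ y) + φ (P x y) = ⟪h x, y⟫ • ξ + η y • h x)
    (hPξ : ∀ x, P x ξ = -φ (h x))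
    (hh : ∀ x y, ⟪h x, y⟫ = ⟪h y, x⟫) (hhξ : ∀ x, η (h x) = 0)
    (hcyc : ∀ x y z, ⟪P x y, z⟫ + ⟪P y z, x⟫ + ⟪P z x, y⟫
      = 2 * α * (η x * ⟪φ y, z⟫ + η y * ⟪φ z, x⟫ + η z * ⟪φ x, y⟫))
    (hN : ∀ x y, P (φ x) y - P (φ y) x + φ (P y x) - φ (P x y) = 0) :
    (∀ x, h x = α • (x - η x • ξ)) ∧ ∀ x y, P x y = α • (⟪φ x, y⟫ • ξ - η y • φ x) := by
  let P₀ : V →ₗ[ℝ] V →ₗ[ℝ] V := LinearMap.mk₂ ℝ (fun x y => α • (⟪φ x, y⟫ • ξ - η y • φ x))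
    (fun x x' y => by simp only [map_add, inner_add_left]; module)
    (fun c x y => by simp only [map_smul, inner_smul_left, conj_trivial]; module)
    (fun x y y' => by simp only [map_add, inner_add_right]; module)
    (fun c x y => by simp only [map_smul, inner_smul_right, smul_eq_mul]; module)
  let k₀ : V →ₗ[ℝ] V := α • (LinearMap.id - η.smulRight ξ)
  have hP₀ (x y) : P₀ x y = α • (⟪φ x, y⟫ • ξ - η y • φ x) := rfl
  have hk₀ (x) : k₀ x = α • (x - η x • ξ) := rfl
  have H := C.eq_zero_of_cosymplectic (Q := P - P₀) (k := h - k₀) ?_ ?_ ?_ ?_ ?_ ?_ ?_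
  · exact ⟨fun x => sub_eq_zero.1 (H.1 x), fun x y => sub_eq_zero.1 (H.2 x y)⟩
  all_goals simp only [LinearMap.sub_apply, hP₀, hk₀]
  · intro x y z
    have := hP x y z
    have := C.inner_ξ_left z
    have := C.inner_ξ y
    have := real_inner_comm y (φ x)
    simp only [inner_sub_left, inner_sub_right, inner_smul_left, inner_smul_right, conj_trivial, *]
    ring
  · intro x y
    have e : P x (φ y) - α • (⟪φ x, φ y⟫ • ξ - η (φ y) • φ x)
        + φ (P x y - α • (⟪φ x, y⟫ • ξ - η y • φ x))
        = (P x (φ y) + φ (P x y)) - α • (⟪φ x, φ y⟫ • ξ - η (φ y) • φ x)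
          - φ (α • (⟪φ x, y⟫ • ξ - η y • φ x)) := by rw [map_sub]; abel
    rw [e, hPφ, C.inner_φ_φ, C.η_φ]
    simp only [map_sub, map_smul, C.φ_ξ, C.φ_φ, inner_sub_left, inner_smul_left, conj_trivial,
      C.inner_ξ_left]
    module
  · intro x
    simp only [hPξ, map_sub, map_smul, C.φ_ξ, C.inner_ξ, C.η_φ, C.η_ξ]
    module
  · intro x y
    have := hh x y
    have := real_inner_comm x y
    simp only [inner_sub_left, inner_smul_left, conj_trivial, C.inner_ξ_left, this, hh x y]
    ring
  · intro x
    simp only [map_sub, map_smul, hhξ, C.η_ξ, smul_eq_mul]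
    ring
  · intro x y z
    have := hcyc x y z
    have e1 := C.inner_φ_left x z
    have e2 := C.inner_φ_left y x
    have e3 := C.inner_φ_left z y
    simp only [inner_sub_left, inner_smul_left, conj_trivial, C.inner_ξ_left]
    rw [e1, e2, e3]
    linear_combination this
  · intro x y
    have e : P (φ x) y - α • (⟪φ (φ x), y⟫ • ξ - η y • φ (φ x))
        - (P (φ y) x - α • (⟪φ (φ y), x⟫ • ξ - η x • φ (φ y)))
        + φ (P y x - α • (⟪φ y, x⟫ • ξ - η x • φ y))
        - φ (P x y - α • (⟪φ x, y⟫ • ξ - η y • φ x))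
        = (P (φ x) y - P (φ y) x + φ (P y x) - φ (P x y))
        - α • (⟪φ (φ x), y⟫ • ξ - η y • φ (φ x)) + α • (⟪φ (φ y), x⟫ • ξ - η x • φ (φ y))
        - φ (α • (⟪φ y, x⟫ • ξ - η x • φ y)) + φ (α • (⟪φ x, y⟫ • ξ - η y • φ x)) := by
      simp only [map_sub]; abel
    have e1 : ⟪φ (φ y), x⟫ = ⟪φ (φ x), y⟫ := by
      rw [C.φ_φ, C.φ_φ, inner_add_left, inner_add_left, inner_neg_left, inner_neg_left,
        inner_smul_left, inner_smul_left, C.inner_ξ_left, C.inner_ξ_left, real_inner_comm,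
        conj_trivial, conj_trivial, mul_comm]
    rw [e, hN, e1]
    simp only [map_sub, map_smul, C.φ_ξ]
    module

end ContactAlgebra

/-- The symmetries of the curvature tensor of a torsion free metric connection; `R x y z` stands
for `R(x, y)z`. -/
structure CurvatureLike (R : V →ₗ[ℝ] V →ₗ[ℝ] V →ₗ[ℝ] V) : Prop where
  skew₁₂ : ∀ x y z, R x y z = -R y x z
  skew₃₄ : ∀ x y z w, ⟪R x y z, w⟫ = -⟪R x y w, z⟫
  bianchi : ∀ x y z, R x y z + R y z x + R z x y = 0

/-- The symmetry of pairs, by the octahedron of four Bianchi identities. -/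
theorem CurvatureLike.pair_symm {R : V →ₗ[ℝ] V →ₗ[ℝ] V →ₗ[ℝ] V} (hR : CurvatureLike R)
    (x y z w : V) : ⟪R x y z, w⟫ = ⟪R z w x, y⟫ := by
  have B (x y z w) : ⟪R x y z, w⟫ + ⟪R y z x, w⟫ + ⟪R z x y, w⟫ = 0 := by
    rw [← inner_add_left, ← inner_add_left, hR.bianchi, inner_zero_left]
  have A (x y z w) : ⟪R x y z, w⟫ = -⟪R y x z, w⟫ := by rw [hR.skew₁₂, inner_neg_left]
  have S := hR.skew₃₄
  linarith [B x y z w, B y z w x, B z w x y, B w x y z, S x y z w, S y z x w, A z x y w,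
    S w x y z, S z w x y, A w y z x, S x z w y, S y w z x]

namespace ContactAlgebra

variable {φ : V →ₗ[ℝ] V} {ξ : V} {η : V →ₗ[ℝ] ℝ} (C : ContactAlgebra φ ξ η)
  {ι : Type*} [Fintype ι] (e : OrthonormalBasis ι ℝ V)

theorem sum_inner_smul (v : V) : ∑ i, ⟪v, e i⟫ • e i = v := by
  conv_rhs => rw [← e.sum_repr' v]
  simp only [real_inner_comm]

theorem sum_inner_mul_inner (v w : V) : ∑ i, ⟪v, e i⟫ * ⟪w, e i⟫ = ⟪v, w⟫ := by
  rw [← e.sum_inner_mul_inner v w]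
  simp only [real_inner_comm]

include C

/-- Moving the skew map `φ` across a metric trace. -/
theorem sum_apply_φ (B : V →ₗ[ℝ] V →ₗ[ℝ] ℝ) :
    ∑ i, B (e i) (φ (e i)) = -∑ i, B (φ (e i)) (e i) := by
  have h1 (i) : B (e i) (φ (e i)) = ∑ j, ⟪φ (e i), e j⟫ * B (e i) (e j) := by
    conv_lhs => rw [← sum_inner_smul e (φ (e i))]
    simp
  have h2 (i) : B (φ (e i)) (e i) = ∑ j, ⟪φ (e i), e j⟫ * B (e j) (e i) := by
    conv_lhs => rw [← sum_inner_smul e (φ (e i))]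
    simp
  simp only [h1, h2]
  rw [Finset.sum_comm, ← Finset.sum_neg_distrib]
  refine Finset.sum_congr rfl fun i _ => ?_
  rw [← Finset.sum_neg_distrib]
  refine Finset.sum_congr rfl fun j _ => ?_
  rw [C.inner_φ_left, neg_mul]

theorem sum_φ_φ (B : V →ₗ[ℝ] V →ₗ[ℝ] ℝ) :
    ∑ i, B (φ (e i)) (φ (e i)) = ∑ i, B (e i) (e i) - B ξ ξ := by
  have h := C.sum_apply_φ e (B ∘ₗ φ)
  have h2 : B ξ ξ = ∑ i, η (e i) * B ξ (e i) := by
    have := congrArg (B ξ) (sum_inner_smul e ξ).symm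
    simpa only [map_sum, map_smul, smul_eq_mul, C.inner_ξ_left] using this
  simp only [LinearMap.comp_apply, C.φ_φ, map_add, map_neg, map_smul, LinearMap.add_apply,
    LinearMap.neg_apply, LinearMap.smul_apply, smul_eq_mul, Finset.sum_add_distrib,
    Finset.sum_neg_distrib] at h
  rw [h, h2]
  ring

/-- For a curvature-like tensor that commutes with `φ`, the `∗`-Ricci tensor is the Ricci
tensor. -/
theorem star_trace_of_commute {W : V →ₗ[ℝ] V →ₗ[ℝ] V →ₗ[ℝ] V} (hW : CurvatureLike W)
    (hφ : ∀ x y z, W x y (φ z) = φ (W x y z)) (v w : V) :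
    ∑ i, ⟪W v (φ w) (φ (e i)), e i⟫ = 2 * ∑ i, ⟪W (e i) v w, e i⟫ := by
  have hη (x y z) : η (W x y z) = 0 := by
    have h0 (x y) : η (W x y ξ) = 0 := by
      have := hW.skew₃₄ x y ξ ξ
      rw [C.inner_ξ] at this
      linarith
    have h1 (x y) : W x y ξ = 0 := by
      have := hφ x y ξ
      have h2 := C.φ_φ (W x y ξ)
      rw [← this, C.φ_ξ, map_zero, map_zero, h0] at h2
      simpa using h2.symm
    rw [← C.inner_ξ, hW.skew₃₄, h1, inner_zero_left, neg_zero]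
  have h1 (u) : ⟪W v (φ w) (φ u), u⟫ = ⟪W u v w, u⟫ + ⟪W (φ u) v w, φ u⟫ := by
    have a := congrArg (fun x => ⟪x, u⟫) (hW.bianchi v (φ w) (φ u))
    simp only [inner_add_left, inner_zero_left] at a
    have b : ⟪W (φ w) (φ u) v, u⟫ = -⟪W u v w, u⟫ := by
      rw [hW.skew₁₂, inner_neg_left, hW.pair_symm, hφ, C.inner_φ_φ, hη, hW.skew₁₂, inner_neg_left,
        hW.skew₃₄]
      ring
    have c : ⟪W (φ u) v (φ w), u⟫ = -⟪W (φ u) v w, φ u⟫ := by rw [hφ, C.skew, neg_neg]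
    linarith
  let B : V →ₗ[ℝ] V →ₗ[ℝ] ℝ := LinearMap.mk₂ ℝ (fun x y => ⟪W x v w, y⟫)
    (fun x x' y => by simp [inner_add_left]) (fun c x y => by simp [inner_smul_left])
    (fun x y y' => by simp [inner_add_right]) (fun c x y => by simp [inner_smul_right])
  have hB (x y) : B x y = ⟪W x v w, y⟫ := rfl
  have h2 := C.sum_φ_φ e B
  simp only [hB, C.inner_ξ, hη, sub_zero] at h2
  simp only [h1, Finset.sum_add_distrib, h2]
  ring

/-- The `∗`-Ricci tensor in terms of the Ricci tensor, for a curvature-like tensor with the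
`φ`-commutation rule of an `α`-cosymplectic manifold: the sum of it and of `α ^ 2` times the
curvature of the unit sphere commutes with `φ`. -/
theorem star_trace_eq {R : V →ₗ[ℝ] V →ₗ[ℝ] V →ₗ[ℝ] V} (hR : CurvatureLike R) {α : ℝ}
    (hφ : ∀ x y z, R x y (φ z) = φ (R x y z)
      + α ^ 2 • (⟪φ y, z⟫ • x - ⟪φ x, z⟫ • y - ⟪x, z⟫ • φ y + ⟪y, z⟫ • φ x)) (v w : V) :
    1 / 2 * ∑ i, ⟪R v (φ w) (φ (e i)), e i⟫ = ∑ i, ⟪R (e i) v w, e i⟫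
      + α ^ 2 * ((Fintype.card ι - 2) * ⟪v, w⟫ + η v * η w) := by
  let S : V →ₗ[ℝ] V →ₗ[ℝ] V →ₗ[ℝ] V :=
    LinearMap.mk₂ ℝ (fun x y => (innerₗ V y).smulRight x - (innerₗ V x).smulRight y)
      (fun x x' y => by ext z; simp; module) (fun c x y => by ext z; simp; module)
      (fun x y y' => by ext z; simp; module) (fun c x y => by ext z; simp; module)
  have hS (x y z) : S x y z = ⟪y, z⟫ • x - ⟪x, z⟫ • y := rfl
  let W := R + α ^ 2 • S
  have hWa (x y z) : W x y z = R x y z + α ^ 2 • (⟪y, z⟫ • x - ⟪x, z⟫ • y) := rfl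
  have hW : CurvatureLike W := by
    refine ⟨fun x y z => ?_, fun x y z w => ?_, fun x y z => ?_⟩ <;> simp only [hWa]
    · rw [hR.skew₁₂]; module
    · rw [inner_add_left, inner_add_left, hR.skew₃₄]
      simp only [inner_sub_left, inner_smul_left, conj_trivial]
      ring
    · rw [real_inner_comm x z, real_inner_comm y x, real_inner_comm z y, ← hR.bianchi x y z] 
      have := hR.bianchi x y z
      module
  have hWφ (x y z) : W x y (φ z) = φ (W x y z) := by
    simp only [hWa, hφ, map_add, map_sub, map_smul, C.skew]
    module
  have h := C.star_trace_of_commute e hW hWφ v w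
  have h1 (u) : ⟪W v (φ w) (φ u), u⟫ = ⟪R v (φ w) (φ u), u⟫
      + α ^ 2 * (⟪φ v, u⟫ * ⟪φ w, u⟫ - ⟪φ (φ w), u⟫ * ⟪v, u⟫) := by
    rw [hWa]
    simp only [inner_add_left, inner_sub_left, inner_smul_left, conj_trivial, C.skew]
    ring
  have h2 (u) : ⟪W u v w, u⟫ = ⟪R u v w, u⟫
      + α ^ 2 * (⟪v, w⟫ * ⟪u, u⟫ - ⟪w, u⟫ * ⟪v, u⟫) := by
    rw [hWa, real_inner_comm u w]
    simp only [inner_add_left, inner_sub_left, inner_smul_left, conj_trivial]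
  have h3 : ∑ i, ⟪e i, e i⟫ = Fintype.card ι := by simp
  simp only [h1, h2, Finset.sum_add_distrib, ← Finset.mul_sum, Finset.sum_sub_distrib,
    sum_inner_mul_inner, h3] at h
  rw [C.φ_φ, inner_add_left, inner_neg_left, inner_smul_left, C.inner_ξ_left, C.inner_φ_φ,
    real_inner_comm v w] at h
  simp only [conj_trivial] at h
  linarith

/-- The trace of `star_trace_eq`: the `∗`-scalar curvature. -/
theorem star_scalar_eq {R : V →ₗ[ℝ] V →ₗ[ℝ] V →ₗ[ℝ] V} (hR : CurvatureLike R) {α : ℝ}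
    (hφ : ∀ x y z, R x y (φ z) = φ (R x y z)
      + α ^ 2 • (⟪φ y, z⟫ • x - ⟪φ x, z⟫ • y - ⟪x, z⟫ • φ y + ⟪y, z⟫ • φ x)) :
    ∑ j, 1 / 2 * ∑ i, ⟪R (e j) (φ (e j)) (φ (e i)), e i⟫ = ∑ j, ∑ i, ⟪R (e i) (e j) (e j), e i⟫
      + α ^ 2 * ((Fintype.card ι : ℝ) - 1) ^ 2 := by
  have h1 : ∑ i, ⟪e i, e i⟫ = Fintype.card ι := by simp
  have h2 : ∑ i, η (e i) * η (e i) = 1 := by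
    simp only [← C.inner_ξ_left, sum_inner_mul_inner]
    rw [C.inner_ξ, C.η_ξ]
  simp only [C.star_trace_eq e hR hφ, Finset.sum_add_distrib, ← Finset.mul_sum, h1, h2]
  ring

end ContactAlgebra

end LinearAlgebra

end

/-! ### Smooth vector fields and smooth tensoriality -/

section

variable {n : ℕ} {M : Type*} [TopologicalSpace M] [ChartedSpace (EuclideanSpace ℝ (Fin n)) M]
  [IsManifold (𝓡 n) ∞ M]

theorem IsSmoothField.mdiffAt {X : VField n M} (hX : IsSmoothField X) (x : M) :
    MDifferentiableAt (𝓡 n) (𝓡 n).tangent (fun y => (⟨y, X y⟩ : TangentBundle (𝓡 n) M)) x :=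
  ContMDiffAt.mdifferentiableAt (hX x) (by simp)

theorem IsSmoothField.add {X Y : VField n M} (hX : IsSmoothField X) (hY : IsSmoothField Y) :
    IsSmoothField (X + Y) :=
  ContMDiff.add_section hX hY

theorem IsSmoothField.sub {X Y : VField n M} (hX : IsSmoothField X) (hY : IsSmoothField Y) :
    IsSmoothField (X - Y) :=
  ContMDiff.sub_section hX hY

theorem IsSmoothField.neg {X : VField n M} (hX : IsSmoothField X) : IsSmoothField (-X) :=
  ContMDiff.neg_section hX

theorem IsSmoothField.smul {u : M → ℝ} {X : VField n M} (hu : ContMDiff (𝓡 n) 𝓘(ℝ, ℝ) ∞ u)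
    (hX : IsSmoothField X) : IsSmoothField (u • X) :=
  ContMDiff.smul_section hu hX

theorem IsSmoothField.const_smul {X : VField n M} (c : ℝ) (hX : IsSmoothField X) :
    IsSmoothField (c • X) :=
  ContMDiff.const_smul_section hX

theorem mdiffAt_of_contMDiff {u : M → ℝ} (hu : ContMDiff (𝓡 n) 𝓘(ℝ, ℝ) ∞ u) (x : M) :
    MDifferentiableAt (𝓡 n) 𝓘(ℝ, ℝ) u x :=
  (hu x).mdifferentiableAt (by simp)

section Extension

variable [T2Space M]

/-- A vector field that is smooth near `x` has the germ at `x` of a globally smooth one. -/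
theorem exists_isSmoothField_eventuallyEq {x : M} {u : Set M} (hu : u ∈ 𝓝 x) {X : VField n M}
    (hX : ContMDiffOn (𝓡 n) (𝓡 n).tangent ∞ (fun y => (⟨y, X y⟩ : TangentBundle (𝓡 n) M)) u) :
    ∃ Y : VField n M, IsSmoothField Y ∧ X =ᶠ[𝓝 x] Y := by
  obtain ⟨v, hvu, hv, hxv⟩ := mem_nhds_iff.1 hu
  obtain ⟨ψ, -, hψ⟩ := (SmoothBumpFunction.nhds_basis_tsupport (I := 𝓡 n) x).mem_iff.1
    (hv.mem_nhds hxv)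
  refine ⟨(ψ : M → ℝ) • X, ?_, ?_⟩
  · exact ContMDiffOn.smul_section_of_tsupport ψ.contMDiff.contMDiffOn hv hψ (hX.mono hvu)
  · filter_upwards [ψ.eventuallyEq_one] with y hy
    rw [Pi.smul_apply', hy, Pi.one_apply, one_smul]

theorem exists_isSmoothField_extend {x : M} (v : TangentSpace (𝓡 n) x) :
    ∃ Y : VField n M, IsSmoothField Y ∧
      (FiberBundle.extend (EuclideanSpace ℝ (Fin n)) v : VField n M) =ᶠ[𝓝 x] Y := by
  obtain ⟨s, hs, h⟩ := FiberBundle.exists_contMDiffOn_extend (k := ∞) (𝓡 n)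
    (EuclideanSpace ℝ (Fin n)) v
  exact exists_isSmoothField_eventuallyEq hs h

/-- A globally smooth vector field with the germ at `x` of Mathlib's local extension of `v`. -/
def extField {x : M} (v : TangentSpace (𝓡 n) x) : VField n M :=
  (exists_isSmoothField_extend v).choose

theorem isSmoothField_extField {x : M} (v : TangentSpace (𝓡 n) x) :
    IsSmoothField (extField v) :=
  (exists_isSmoothField_extend v).choose_spec.1

theorem extend_eventuallyEq_extField {x : M} (v : TangentSpace (𝓡 n) x) :
    (FiberBundle.extend (EuclideanSpace ℝ (Fin n)) v : VField n M) =ᶠ[𝓝 x] extField v :=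
  (exists_isSmoothField_extend v).choose_spec.2

@[simp]
theorem extField_self {x : M} (v : TangentSpace (𝓡 n) x) : extField v x = v := by
  rw [← (extend_eventuallyEq_extField v).self_of_nhds, FiberBundle.extend_apply_self]

/-- An operation on smooth vector fields that is linear over the smooth functions, when the latter
act on its target by their values at `x`. -/
structure SmoothTensorialAt {A : Type*} [AddCommGroup A] [Module ℝ A] (x : M)
    (Ψ : VField n M → A) : Prop where
  smul : ∀ (u : M → ℝ) (X : VField n M), ContMDiff (𝓡 n) 𝓘(ℝ, ℝ) ∞ u → IsSmoothField X →
    Ψ (u • X) = u x • Ψ X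
  add : ∀ X Y : VField n M, IsSmoothField X → IsSmoothField Y → Ψ (X + Y) = Ψ X + Ψ Y

namespace SmoothTensorialAt

variable {A : Type*} [AddCommGroup A] [Module ℝ A] {x : M} {Ψ : VField n M → A}

theorem sum (h : SmoothTensorialAt x Ψ) {ι : Type*} (s : Finset ι) (X : ι → VField n M)
    (hX : ∀ i, IsSmoothField (X i)) :
    IsSmoothField (∑ i ∈ s, X i) ∧ Ψ (∑ i ∈ s, X i) = ∑ i ∈ s, Ψ (X i) := by
  classical
  have hz : IsSmoothField (0 : VField n M) := contMDiff_zeroSection ℝ _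
  induction s using Finset.induction_on with
  | empty =>
    refine ⟨hz, ?_⟩
    have := h.smul 0 0 contMDiff_const hz
    simpa using this
  | insert a s ha ih =>
    rw [Finset.sum_insert ha, Finset.sum_insert ha, ← ih.2]
    exact ⟨(hX a).add ih.1, h.add _ _ (hX a) ih.1⟩

/-- A tensorial operation sees only the value at `x`: with a bump function `ψ` and a local frame
`s i`, the field `ψ ^ 2 • X` is the sum of the `(ψ * c i) • (ψ • s i)`, where `c i` are the
coefficients of `X`. -/
theorem pointwise (h : SmoothTensorialAt x Ψ) {X Y : VField n M} (hX : IsSmoothField X)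
    (hY : IsSmoothField Y) (hXY : X x = Y x) : Ψ X = Ψ Y := by
  let t := trivializationAt (EuclideanSpace ℝ (Fin n)) (fun x : M => TangentSpace (𝓡 n) x) x
  have x_mem : x ∈ t.baseSet := FiberBundle.mem_baseSet_trivializationAt _ _ x
  let b := Module.Basis.ofVectorSpace ℝ (EuclideanSpace ℝ (Fin n))
  let s := t.localFrame b
  let c := t.localFrameCoeff (𝓡 n) b
  obtain ⟨ψ, -, hψ⟩ := (SmoothBumpFunction.nhds_basis_tsupport (I := 𝓡 n) x).mem_iff.1
    (t.open_baseSet.mem_nhds x_mem)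
  have hψ1 : ψ x = 1 := ψ.eq_one
  have hs (i) : IsSmoothField ((ψ : M → ℝ) • s i) :=
    ContMDiffOn.smul_section_of_tsupport ψ.contMDiff.contMDiffOn t.open_baseSet hψ
      (t.contMDiffOn_localFrame_baseSet ∞ b i)
  have hc {Z : VField n M} (hZ : IsSmoothField Z) (i) :
      ContMDiff (𝓡 n) 𝓘(ℝ, ℝ) ∞ (fun y => ψ y * c i y (Z y)) := by
    have h1 : ContMDiffOn (𝓡 n) 𝓘(ℝ, ℝ) ∞ (fun y => c i y (Z y)) t.baseSet :=
      contMDiffOn_baseSet_localFrameCoeff b (hZ.contMDiffOn) i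
    refine contMDiff_of_tsupport fun y hy => ?_
    have hy' : y ∈ t.baseSet := hψ (closure_mono (Function.support_mul_subset_left _ _) hy)
    exact ψ.contMDiffAt.mul (h1.contMDiffAt (t.open_baseSet.mem_nhds hy'))
  have key {Z : VField n M} (hZ : IsSmoothField Z) :
      Ψ Z = ∑ i, c i x (Z x) • Ψ ((ψ : M → ℝ) • s i) := by
    have h1 : Ψ ((fun y => ψ y * ψ y) • Z) = Ψ Z := by
      rw [h.smul (fun y => ψ y * ψ y) _ (ψ.contMDiff.mul ψ.contMDiff) hZ, hψ1, one_mul, one_smul]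
    have h2 : (fun y => ψ y * ψ y) • Z =
        ∑ i, (fun y => ψ y * c i y (Z y)) • ((ψ : M → ℝ) • s i) := by
      funext y
      simp only [Finset.sum_apply, Pi.smul_apply']
      by_cases hy : y ∈ t.baseSet
      · conv_lhs => rw [t.eq_sum_localFrameCoeff_smul (I := 𝓡 n) (b := b) (s := Z) hy]
        rw [Finset.smul_sum]
        refine Finset.sum_congr rfl fun i _ => ?_
        simp only [smul_smul]
        congr 1
        ring
      · have h0 : ψ y = 0 := image_eq_zero_of_notMem_tsupport fun hy' => hy (hψ hy')
        simp [h0]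
    rw [← h1, h2, (h.sum _ _ fun i => (hs i).smul (hc hZ i)).2]
    refine Finset.sum_congr rfl fun i _ => ?_
    rw [h.smul _ _ (hc hZ i) (hs i), hψ1, one_mul]
  rw [key hX, key hY, hXY]

/-- The linear map on `T_x M` given by a tensorial operation. -/
def toLinearMap (h : SmoothTensorialAt x Ψ) : TangentSpace (𝓡 n) x →ₗ[ℝ] A where
  toFun v := Ψ (extField v)
  map_add' v w := by
    rw [← h.add _ _ (isSmoothField_extField v) (isSmoothField_extField w)]
    exact h.pointwise (isSmoothField_extField _)
      ((isSmoothField_extField v).add (isSmoothField_extField w)) (by simp)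
  map_smul' c v := by
    have h1 := h.smul (fun _ => c) (extField v) contMDiff_const (isSmoothField_extField v)
    rw [RingHom.id_apply, ← h1]
    exact h.pointwise (isSmoothField_extField _)
      ((isSmoothField_extField v).smul contMDiff_const) (by simp)

theorem toLinearMap_apply (h : SmoothTensorialAt x Ψ) {X : VField n M} (hX : IsSmoothField X) :
    h.toLinearMap (X x) = Ψ X :=
  h.pointwise (isSmoothField_extField _) hX (by simp)

end SmoothTensorialAt

end Extension

end

/-! ### Connections on smooth fields, and germs -/

section

variable {n : ℕ} {M : Type*} [TopologicalSpace M] [ChartedSpace (EuclideanSpace ℝ (Fin n)) M]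
  [IsManifold (𝓡 n) ∞ M]

section Connection

variable (D : LinearConnection n M) {X Y Z : VField n M} (x : M)

theorem cov_add (hX : IsSmoothField X) (hY : IsSmoothField Y) :
    D (X + Y) x = D X x + D Y x :=
  D.isCovariantDerivativeOn.add (hX.mdiffAt x) (hY.mdiffAt x) (Set.mem_univ x)

theorem cov_smul {u : M → ℝ} (hu : ContMDiff (𝓡 n) 𝓘(ℝ, ℝ) ∞ u) (hX : IsSmoothField X)
    (v : TangentSpace (𝓡 n) x) :
    D (u • X) x v = u x • D X x v + mvfderiv (𝓡 n) u x v • X x := by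
  rw [D.isCovariantDerivativeOn.leibniz (hX.mdiffAt x) (mdiffAt_of_contMDiff hu x)
    (Set.mem_univ x)]
  rfl

theorem cov_const_smul (c : ℝ) (hX : IsSmoothField X) : D (c • X) x = c • D X x :=
  D.isCovariantDerivativeOn.smul_const c (hX.mdiffAt x) (Set.mem_univ x)

theorem cov_neg (hX : IsSmoothField X) : D (-X) x = -D X x := by
  rw [← neg_one_smul ℝ X, cov_const_smul D x _ hX, neg_one_smul]

theorem cov_sub (hX : IsSmoothField X) (hY : IsSmoothField Y) :
    D (X - Y) x = D X x - D Y x := by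
  rw [sub_eq_add_neg, cov_add D x hX hY.neg, cov_neg D x hY, sub_eq_add_neg]

/-- A connection depends only on the germ of the section it differentiates. -/
theorem cov_congr (hY : IsSmoothField Y) (hXY : X =ᶠ[𝓝 x] Y) : D X x = D Y x := by
  have h : MDifferentiableAt (𝓡 n) (𝓡 n).tangent
      (fun y => (⟨y, X y⟩ : TangentBundle (𝓡 n) M)) x :=
    (hY.mdiffAt x).congr_of_eventuallyEq (hXY.mono fun y hy => by simp only [hy])
  exact D.isCovariantDerivativeOn.congr_of_eventuallyEq h (hY.mdiffAt x) Filter.univ_mem hXY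

end Connection

/-- The connection maps pairs of smooth vector fields to smooth vector fields. -/
def IsSmoothConnection (D : LinearConnection n M) : Prop :=
  ∀ X Y : VField n M, IsSmoothField X → IsSmoothField Y → IsSmoothField (cov D X Y)

/-- `X(u)` is the fibre component of `du ∘ X`. -/
theorem IsSmoothField.dirDeriv {X : VField n M} (hX : IsSmoothField X) {u : M → ℝ}
    (hu : ContMDiff (𝓡 n) 𝓘(ℝ, ℝ) ∞ u) : ContMDiff (𝓡 n) 𝓘(ℝ, ℝ) ∞ (dirDeriv X u) := by
  have h : ContMDiff (𝓡 n) 𝓘(ℝ, ℝ).tangent ∞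
      (fun x => tangentMap (𝓡 n) 𝓘(ℝ, ℝ) u (⟨x, X x⟩ : TangentBundle (𝓡 n) M)) :=
    (hu.contMDiff_tangentMap (m := ∞) (by simp)).comp hX
  exact (contMDiff_snd_tangentBundle_modelSpace ℝ 𝓘(ℝ, ℝ)).comp h

/-- Curvature depends only on the germs of the fields. -/
theorem curvField_congr {D : LinearConnection n M} (hD : IsSmoothConnection D)
    {X Y Z X' Y' Z' : VField n M} (x : M) (hX : IsSmoothField X') (hY : IsSmoothField Y')
    (hZ : IsSmoothField Z') (hXX : X =ᶠ[𝓝 x] X') (hYY : Y =ᶠ[𝓝 x] Y') (hZZ : Z =ᶠ[𝓝 x] Z') :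
    curvField D X Y Z x = curvField D X' Y' Z' x := by
  have h {Y Y' : VField n M} (hYY : Y =ᶠ[𝓝 x] Y') : cov D Y Z =ᶠ[𝓝 x] cov D Y' Z' := by
    filter_upwards [hYY, hZZ.eventuallyEq_nhds] with y h1 h2
    rw [cov, cov, cov_congr D y hZ h2, h1]
  simp only [curvField, Pi.sub_apply]
  rw [cov, cov, cov, cov_congr D x (hD _ _ hY hZ) (h hYY), cov_congr D x (hD _ _ hX hZ) (h hXX),
    cov_congr D x hZ hZZ, hXX.mlieBracket_vectorField_eq hYY, hXX.self_of_nhds, hYY.self_of_nhds]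
  rfl

/-- The curvature tensor, which is defined by local extensions, computed with global ones. -/
theorem curv_eq_extField [T2Space M] {D : LinearConnection n M} (hD : IsSmoothConnection D) (x : M)
    (u v w : TangentSpace (𝓡 n) x) :
    curv D x u v w = curvField D (extField u) (extField v) (extField w) x :=
  curvField_congr hD x (isSmoothField_extField u) (isSmoothField_extField v)
    (isSmoothField_extField w) (extend_eventuallyEq_extField u) (extend_eventuallyEq_extField v)
    (extend_eventuallyEq_extField w)

end

/-! ### Lie brackets and the curvature tensor -/

section

variable {n : ℕ} {M : Type*} [TopologicalSpace M] [ChartedSpace (EuclideanSpace ℝ (Fin n)) M]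
  [IsManifold (𝓡 n) ∞ M]

section Bracket

variable {X Y Z : VField n M} {u v : M → ℝ} (x : M)

theorem mlieBracket_smul_right_of_smooth (hu : ContMDiff (𝓡 n) 𝓘(ℝ, ℝ) ∞ u) (hY : IsSmoothField Y) :
    mlieBracket (𝓡 n) X (u • Y) x = dirDeriv X u x • Y x + u x • mlieBracket (𝓡 n) X Y x :=
  mlieBracket_smul_right (mdiffAt_of_contMDiff hu x) (hY.mdiffAt x)

theorem mlieBracket_smul_left_of_smooth (hu : ContMDiff (𝓡 n) 𝓘(ℝ, ℝ) ∞ u) (hX : IsSmoothField X) :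
    mlieBracket (𝓡 n) (u • X) Y x = -dirDeriv Y u x • X x + u x • mlieBracket (𝓡 n) X Y x :=
  mlieBracket_smul_left (mdiffAt_of_contMDiff hu x) (hX.mdiffAt x)

theorem minSmoothness_le_infty (k : ℕ) : minSmoothness ℝ k ≤ (∞ : WithTop ℕ∞) := by
  rw [minSmoothness_of_isRCLikeNormedField]
  exact_mod_cast (le_top : (k : ℕ∞) ≤ ⊤)

theorem IsSmoothField.mlieBracket (hX : IsSmoothField X) (hY : IsSmoothField Y) :
    IsSmoothField (mlieBracket (𝓡 n) X Y) := by
  have : IsManifold (𝓡 n) (minSmoothness ℝ 2) M := IsManifold.of_le (minSmoothness_le_infty 2)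
  have : IsManifold (𝓡 n) (((⊤ : ℕ∞) : WithTop ℕ∞) + 1) M := inferInstanceAs (IsManifold _ ∞ M)
  exact ContDiff.mlieBracket_vectorField (m := ⊤) (n := ⊤) hX hY (by simp)

theorem jacobi (hX : IsSmoothField X) (hY : IsSmoothField Y) (hZ : IsSmoothField Z) :
    mlieBracket (𝓡 n) X (mlieBracket (𝓡 n) Y Z) x =
      mlieBracket (𝓡 n) (mlieBracket (𝓡 n) X Y) Z x
        + mlieBracket (𝓡 n) Y (mlieBracket (𝓡 n) X Z) x := by
  have : IsManifold (𝓡 n) (minSmoothness ℝ 3) M := IsManifold.of_le (minSmoothness_le_infty 3)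
  exact leibniz_identity_mlieBracket_apply ((hX x).of_le (minSmoothness_le_infty 2))
    ((hY x).of_le (minSmoothness_le_infty 2)) ((hZ x).of_le (minSmoothness_le_infty 2))

/-- The bracket is the commutator of derivations. This follows from the Jacobi identity for `X`,
`Y` and `u • Z`. -/
theorem dirDeriv_mlieBracket (hX : IsSmoothField X) (hY : IsSmoothField Y)
    (hu : ContMDiff (𝓡 n) 𝓘(ℝ, ℝ) ∞ u) (hZ : IsSmoothField Z) (hZx : Z x ≠ 0) :
    dirDeriv (mlieBracket (𝓡 n) X Y) u x
      = dirDeriv X (dirDeriv Y u) x - dirDeriv Y (dirDeriv X u) x := by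
  have e {Y : VField n M} : mlieBracket (𝓡 n) Y (u • Z)
      = dirDeriv Y u • Z + u • mlieBracket (𝓡 n) Y Z :=
    funext fun y => mlieBracket_smul_right_of_smooth y hu hZ
  have a {X Y : VField n M} (hX : IsSmoothField X) (hY : IsSmoothField Y) :
      mlieBracket (𝓡 n) X (mlieBracket (𝓡 n) Y (u • Z)) x
      = dirDeriv X (dirDeriv Y u) x • Z x + dirDeriv Y u x • mlieBracket (𝓡 n) X Z x
        + (dirDeriv X u x • mlieBracket (𝓡 n) Y Z x
          + u x • mlieBracket (𝓡 n) X (mlieBracket (𝓡 n) Y Z) x) := by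
    rw [e, mlieBracket_add_right ((hZ.smul (hY.dirDeriv hu)).mdiffAt x)
      (((hY.mlieBracket hZ).smul hu).mdiffAt x), mlieBracket_smul_right_of_smooth x (hY.dirDeriv hu) hZ,
      mlieBracket_smul_right_of_smooth x hu (hY.mlieBracket hZ)]
  have h := jacobi x hX hY (hZ.smul hu)
  rw [a hX hY, a hY hX, e, Pi.add_apply, Pi.smul_apply', Pi.smul_apply', jacobi x hX hY hZ] at h
  have h2 : (dirDeriv (mlieBracket (𝓡 n) X Y) u x
      - (dirDeriv X (dirDeriv Y u) x - dirDeriv Y (dirDeriv X u) x)) • Z x = 0 := by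
    rw [← neg_eq_zero, ← sub_eq_zero.2 h]
    module
  exact sub_eq_zero.1 ((smul_eq_zero.1 h2).resolve_right hZx)

end Bracket

section Tensoriality

variable {D : LinearConnection n M} (hD : IsSmoothConnection D) {X Y Z : VField n M} {x : M}

theorem curvField_apply (X Y Z : VField n M) (x : M) : curvField D X Y Z x
    = D (cov D Y Z) x (X x) - D (cov D X Z) x (Y x) - D Z x (mlieBracket (𝓡 n) X Y x) := rfl

theorem curvField_swap (X Y Z : VField n M) (x : M) :
    curvField D X Y Z x = -curvField D Y X Z x := by
  rw [curvField_apply, curvField_apply, mlieBracket_swap_apply, map_neg]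
  abel

include hD

theorem tensorial_curvField_left (hZ : IsSmoothField Z) :
    SmoothTensorialAt x (fun X => curvField D X Y Z x) where
  smul u X hu hX := by
    have e : cov D (u • X) Z = u • cov D X Z := by
      funext y; simp [cov]
    simp only [curvField_apply, e, cov_smul D x hu (hD _ _ hX hZ),
      mlieBracket_smul_left_of_smooth x hu hX, Pi.smul_apply', map_smul, map_add]
    simp only [dirDeriv, cov]
    module
  add X X' hX hX' := by
    have e : cov D (X + X') Z = cov D X Z + cov D X' Z := by
      funext y; simp [cov]
    simp only [curvField_apply, e, cov_add D x (hD _ _ hX hZ) (hD _ _ hX' hZ),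
      mlieBracket_add_left (hX.mdiffAt x) (hX'.mdiffAt x), Pi.add_apply, map_add]
    simp only [_root_.add_apply]
    abel

theorem tensorial_curvField_middle (hZ : IsSmoothField Z) :
    SmoothTensorialAt x (fun Y => curvField D X Y Z x) where
  smul u Y hu hY := by
    rw [curvField_swap, (tensorial_curvField_left hD hZ).smul u Y hu hY, curvField_swap,
      smul_neg, neg_neg]
  add Y Y' hY hY' := by
    rw [curvField_swap, (tensorial_curvField_left hD hZ).add Y Y' hY hY', neg_add,
      ← curvField_swap, ← curvField_swap]

/-- The second derivatives of the coefficient cancel by `dirDeriv_mlieBracket`. -/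
theorem tensorial_curvField_right (hX : IsSmoothField X) (hY : IsSmoothField Y) :
    SmoothTensorialAt x (fun Z => curvField D X Y Z x) where
  smul u Z hu hZ := by
    have e {Y : VField n M} : cov D Y (u • Z) = u • cov D Y Z + dirDeriv Y u • Z := by
      funext y; exact cov_smul D y hu hZ _
    have a {X Y : VField n M} (hX : IsSmoothField X) (hY : IsSmoothField Y) :
        D (cov D Y (u • Z)) x (X x) = u x • D (cov D Y Z) x (X x) + dirDeriv X u x • cov D Y Z x
          + (dirDeriv Y u x • D Z x (X x) + dirDeriv X (dirDeriv Y u) x • Z x) := by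
      rw [e, cov_add D x ((hD _ _ hY hZ).smul hu) (hZ.smul (hY.dirDeriv hu)),
        _root_.add_apply, cov_smul D x hu (hD _ _ hY hZ),
        cov_smul D x (hY.dirDeriv hu) hZ]
      rfl
    by_cases hZx : Z x = 0
    · simp only [curvField_apply, a hX hY, a hY hX, cov_smul D x hu hZ, hZx]
      simp only [dirDeriv, cov]
      module
    · have h := dirDeriv_mlieBracket x hX hY hu hZ hZx
      simp only [curvField_apply, a hX hY, a hY hX, cov_smul D x hu hZ]
      rw [← dirDeriv, h]
      simp only [dirDeriv, cov]
      module
  add Z Z' hZ hZ' := by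
    have e {Y : VField n M} : cov D Y (Z + Z') = cov D Y Z + cov D Y Z' := by
      funext y; simp [cov, cov_add D y hZ hZ']
    simp only [curvField_apply, e, cov_add D x (hD _ _ hX hZ) (hD _ _ hX hZ'),
      cov_add D x (hD _ _ hY hZ) (hD _ _ hY hZ'), cov_add D x hZ hZ']
    simp only [_root_.add_apply]
    abel

variable [T2Space M]

/-- The curvature tensor at `x` as a trilinear map. -/
def curvatureTensor (x : M) : TangentSpace (𝓡 n) x →ₗ[ℝ] TangentSpace (𝓡 n) x →ₗ[ℝ]
    TangentSpace (𝓡 n) x →ₗ[ℝ] TangentSpace (𝓡 n) x :=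
  LinearMap.mk₂ ℝ (fun u v => (tensorial_curvField_right (x := x) hD (isSmoothField_extField u)
      (isSmoothField_extField v)).toLinearMap)
    (fun u u' v => LinearMap.ext fun w => (tensorial_curvField_left hD (Y := extField v)
      (isSmoothField_extField w)).toLinearMap.map_add u u')
    (fun c u v => LinearMap.ext fun w => (tensorial_curvField_left hD (Y := extField v)
      (isSmoothField_extField w)).toLinearMap.map_smul c u)
    (fun u v v' => LinearMap.ext fun w => (tensorial_curvField_middle hD (X := extField u)
      (isSmoothField_extField w)).toLinearMap.map_add v v')
    (fun c u v => LinearMap.ext fun w => (tensorial_curvField_middle hD (X := extField u)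
      (isSmoothField_extField w)).toLinearMap.map_smul c v)

theorem curvatureTensor_apply (hX : IsSmoothField X) (hY : IsSmoothField Y) (hZ : IsSmoothField Z)
    (x : M) : curvatureTensor hD x (X x) (Y x) (Z x) = curvField D X Y Z x := by
  trans curvField D (extField (X x)) (extField (Y x)) Z x
  · exact (tensorial_curvField_right hD (isSmoothField_extField _)
      (isSmoothField_extField _)).toLinearMap_apply hZ
  trans curvField D (extField (X x)) Y Z x
  · exact (tensorial_curvField_middle hD (X := extField (X x)) hZ).toLinearMap_apply hY
  · exact (tensorial_curvField_left hD (Y := Y) hZ).toLinearMap_apply hX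

theorem curv_eq_curvatureTensor (x : M)
    (u v w : TangentSpace (𝓡 n) x) : curv D x u v w = curvatureTensor hD x u v w := by
  rw [curv_eq_extField hD]
  rfl

end Tensoriality

end

/-! ### The covariant derivative of `φ`, and the symmetries of the Levi-Civita curvature -/

section

variable {n : ℕ} {M : Type*} [TopologicalSpace M] [ChartedSpace (EuclideanSpace ℝ (Fin n)) M]
  [IsManifold (𝓡 n) ∞ M] [RiemannianBundle (fun x : M => TangentSpace (𝓡 n) x)]

namespace AlmostContactMetric

variable (A : AlmostContactMetric n M)

theorem contactAlgebra (x : M) :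
    ContactAlgebra (A.φ x : TangentSpace (𝓡 n) x →ₗ[ℝ] TangentSpace (𝓡 n) x) (A.ξ x)
      (A.η x : TangentSpace (𝓡 n) x →ₗ[ℝ] ℝ) where
  φ_φ := A.φ_φ x
  η_ξ := A.η_ξ x
  η_φ := A.η_φ x
  φ_ξ := A.φ_ξ x
  skew := A.skew x
  inner_ξ := A.inner_ξ x

/-- The field `φ X`. -/
def φField (X : VField n M) : VField n M := fun x => A.φ x (X x)

@[simp] theorem φField_apply (X : VField n M) (x : M) : A.φField X x = A.φ x (X x) := rfl

variable {A} in
theorem _root_.StarYamabe.IsSmoothField.φField {X : VField n M} (hX : IsSmoothField X) :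
    IsSmoothField (A.φField X) :=
  A.smooth_φ X hX

theorem ξ_ne_zero (x : M) : A.ξ x ≠ 0 := fun h => by simpa [h] using A.η_ξ x

theorem η_eq_inner (Y : VField n M) : (fun y => A.η y (Y y)) = fun y => ⟪Y y, A.ξ y⟫ :=
  funext fun y => (A.inner_ξ y (Y y)).symm

section

variable (D : LinearConnection n M)

/-- `(D_v φ) Y = D_v (φ Y) - φ (D_v Y)` is tensorial in `Y`. -/
theorem tensorial_covφ (x : M) : SmoothTensorialAt x (fun Y : VField n M =>
    ((D (A.φField Y) x - (A.φ x).comp (D Y x) :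
      TangentSpace (𝓡 n) x →L[ℝ] TangentSpace (𝓡 n) x) :
      TangentSpace (𝓡 n) x →ₗ[ℝ] TangentSpace (𝓡 n) x)) where
  smul u Y hu hY := by
    have e : A.φField (u • Y) = u • A.φField Y := by funext y; simp
    ext v
    simp only [ContinuousLinearMap.coe_coe, _root_.sub_apply, ContinuousLinearMap.comp_apply, e,
      cov_smul D x hu hY, cov_smul D x hu hY.φField, LinearMap.smul_apply, map_add, map_smul,
      φField_apply]
    module
  add Y Y' hY hY' := by
    have e : A.φField (Y + Y') = A.φField Y + A.φField Y' := by funext y; simp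
    ext v
    simp only [ContinuousLinearMap.coe_coe, _root_.sub_apply, ContinuousLinearMap.comp_apply, e,
      cov_add D x hY hY', cov_add D x hY.φField hY'.φField, LinearMap.add_apply, map_add,
      _root_.add_apply]
    abel

/-- The covariant derivative of `φ`, as a tensor: `covφ D x v w` is `(D_v φ) w`. -/
def covφ [T2Space M] (x : M) :
    TangentSpace (𝓡 n) x →ₗ[ℝ] TangentSpace (𝓡 n) x →ₗ[ℝ] TangentSpace (𝓡 n) x :=
  (A.tensorial_covφ D x).toLinearMap.flip

theorem covφ_apply [T2Space M] {Y : VField n M} (hY : IsSmoothField Y) (x : M)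
    (v : TangentSpace (𝓡 n) x) :
    A.covφ D x v (Y x) = D (A.φField Y) x v - A.φ x (D Y x v) := by
  rw [covφ, LinearMap.flip_apply, (A.tensorial_covφ D x).toLinearMap_apply hY]
  rfl

theorem cov_φField [T2Space M] {Y : VField n M} (hY : IsSmoothField Y) (x : M)
    (v : TangentSpace (𝓡 n) x) :
    D (A.φField Y) x v = A.covφ D x v (Y x) + A.φ x (D Y x v) := by
  rw [A.covφ_apply D hY, sub_add_cancel]

/-- The derivative of `φ ξ = 0`. -/
theorem covφ_ξ [T2Space M] (x : M) (u : TangentSpace (𝓡 n) x) :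
    A.covφ D x u (A.ξ x) = -A.φ x (D A.ξ x u) := by
  have e : A.φField A.ξ = 0 := funext A.φ_ξ
  rw [A.covφ_apply D A.smooth_ξ, e, D.zero]
  simp

end

end AlmostContactMetric

variable [IsContMDiffRiemannianBundle (𝓡 n) ∞ (EuclideanSpace ℝ (Fin n))
  (fun x : M => TangentSpace (𝓡 n) x)]

theorem IsSmoothField.inner {X Y : VField n M} (hX : IsSmoothField X) (hY : IsSmoothField Y) :
    ContMDiff (𝓡 n) 𝓘(ℝ, ℝ) ∞ (fun y => ⟪X y, Y y⟫) :=
  ContMDiff.inner_bundle hX hY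

theorem IsMetric.deriv_inner {D : LinearConnection n M} (hD : IsMetric D) {Y Z : VField n M}
    (hY : IsSmoothField Y) (hZ : IsSmoothField Z) (X : VField n M) (x : M) :
    dirDeriv X (fun y => ⟪Y y, Z y⟫) x = ⟪D Y x (X x), Z x⟫ + ⟪Y x, D Z x (X x)⟫ := by
  have := riemannianBundle_one (n := n) (M := M)
  exact CovariantDerivative.IsMetricCompatible.mvfderiv_inner_eq hD X (hY.mdiffAt x) (hZ.mdiffAt x)

theorem IsLeviCivita.mlieBracket_eq {D : LinearConnection n M} (hD : IsLeviCivita D)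
    {X Y : VField n M}
    (hX : IsSmoothField X) (hY : IsSmoothField Y) (x : M) :
    mlieBracket (𝓡 n) X Y x = D Y x (X x) - D X x (Y x) := by
  have h := D.torsion_apply (hX.mdiffAt x) (hY.mdiffAt x)
  rw [hD.torsion_free] at h
  exact (sub_eq_zero.1 h.symm).symm

section LeviCivita

variable {D : LinearConnection n M} (hD : IsLeviCivita D)
include hD

theorem IsLeviCivita.isSmoothConnection : IsSmoothConnection D := hD.smooth

/-- The first Bianchi identity is the Jacobi identity, as the torsion vanishes. -/
theorem IsLeviCivita.bianchi {X Y Z : VField n M} (hX : IsSmoothField X) (hY : IsSmoothField Y)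
    (hZ : IsSmoothField Z) (x : M) :
    curvField D X Y Z x + curvField D Y Z X x + curvField D Z X Y x = 0 := by
  have e {X Y : VField n M} (hX : IsSmoothField X) (hY : IsSmoothField Y) :
      mlieBracket (𝓡 n) X Y = cov D X Y - cov D Y X := funext fun y => hD.mlieBracket_eq hX hY y
  have s := hD.smooth
  have a {X Y Z : VField n M} (hX : IsSmoothField X) (hY : IsSmoothField Y)
      (hZ : IsSmoothField Z) : mlieBracket (𝓡 n) X (mlieBracket (𝓡 n) Y Z) x
      = D (cov D Y Z) x (X x) - D (cov D Z Y) x (X x) - D X x (mlieBracket (𝓡 n) Y Z x) := by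
    rw [hD.mlieBracket_eq hX (hY.mlieBracket hZ)]
    conv_lhs => enter [1]; rw [e hY hZ, cov_sub D x (s _ _ hY hZ) (s _ _ hZ hY)]
    rfl
  have j := jacobi x hX hY hZ
  rw [mlieBracket_swap_apply (V := mlieBracket (𝓡 n) X Y), a hX hY hZ, a hZ hX hY, a hY hX hZ,
    mlieBracket_swap_apply (V := X) (W := Z), map_neg] at j
  rw [← sub_eq_zero.2 j]
  simp only [curvField_apply]
  abel

/-- The structure `A` only supplies the nonvanishing field `ξ` for `dirDeriv_mlieBracket`. -/
theorem IsLeviCivita.curvatureLike [T2Space M] {A : AlmostContactMetric n M} (x : M) :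
    CurvatureLike (curvatureTensor hD.isSmoothConnection x) where
  skew₁₂ u v w := by
    simp only [← curv_eq_curvatureTensor, curv_eq_extField hD.isSmoothConnection]
    exact curvField_swap _ _ _ _
  bianchi u v w := by
    simp only [← curv_eq_curvatureTensor, curv_eq_extField hD.isSmoothConnection]
    exact hD.bianchi (isSmoothField_extField u) (isSmoothField_extField v)
      (isSmoothField_extField w) x
  skew₃₄ u v w z := by
    simp only [← curv_eq_curvatureTensor, curv_eq_extField hD.isSmoothConnection]
    have hX := isSmoothField_extField u
    have hY := isSmoothField_extField v
    have hZ := isSmoothField_extField w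
    have hW := isSmoothField_extField z
    have s := hD.smooth
    have h := dirDeriv_mlieBracket x hX hY (hZ.inner hW) A.smooth_ξ (A.ξ_ne_zero x)
    have a {X Y : VField n M} (hX : IsSmoothField X) (hY : IsSmoothField Y) :
        dirDeriv X (dirDeriv Y (fun y => ⟪extField w y, extField z y⟫)) x
        = ⟪D (cov D Y (extField w)) x (X x), z⟫ + ⟪D (extField w) x (Y x), D (extField z) x (X x)⟫
          + (⟪D (extField w) x (X x), D (extField z) x (Y x)⟫
            + ⟪w, D (cov D Y (extField z)) x (X x)⟫) := by
      have e : dirDeriv Y (fun y => ⟪extField w y, extField z y⟫) =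
          (fun y => ⟪cov D Y (extField w) y, extField z y⟫)
          + (fun y => ⟪extField w y, cov D Y (extField z) y⟫) :=
        funext fun y => hD.metric.deriv_inner hZ hW Y y
      have i1 := (s _ _ hY hZ).inner hW
      have i2 := hZ.inner (s _ _ hY hW)
      rw [e, dirDeriv, mvfderiv_add (mdiffAt_of_contMDiff i1 x) (mdiffAt_of_contMDiff i2 x),
        _root_.add_apply]
      have := hD.metric.deriv_inner (s _ _ hY hZ) hW X x
      have := hD.metric.deriv_inner hZ (s _ _ hY hW) X x
      simp only [dirDeriv] at *
      simp only [*, extField_self]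
      rfl
    rw [hD.metric.deriv_inner hZ hW, a hX hY, a hY hX] at h
    have c (w z : TangentSpace (𝓡 n) x) := real_inner_comm z w
    simp only [curvField_apply, inner_sub_left, extField_self] at h ⊢
    linarith [c w (D (cov D (extField v) (extField z)) x u),
      c w (D (cov D (extField u) (extField z)) x v),
      c w (D (extField z) x (mlieBracket (𝓡 n) (extField u) (extField v) x))]

end LeviCivita

end

/-! ### The structure equations of an `α`-cosymplectic manifold -/

section

variable {n : ℕ} {M : Type*} [TopologicalSpace M] [ChartedSpace (EuclideanSpace ℝ (Fin n)) M]
  [IsManifold (𝓡 n) ∞ M] [RiemannianBundle (fun x : M => TangentSpace (𝓡 n) x)]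
  [IsContMDiffRiemannianBundle (𝓡 n) ∞ (EuclideanSpace ℝ (Fin n))
    (fun x : M => TangentSpace (𝓡 n) x)]

namespace AlmostContactMetric

variable (A : AlmostContactMetric n M)

section Metric

variable {D : LinearConnection n M} (hD : IsMetric D)
include hD

theorem deriv_η {Y : VField n M} (hY : IsSmoothField Y) (X : VField n M) (x : M) :
    dirDeriv X (fun y => A.η y (Y y)) x = A.η x (D Y x (X x)) + ⟪D A.ξ x (X x), Y x⟫ := by
  rw [A.η_eq_inner, hD.deriv_inner hY A.smooth_ξ, A.inner_ξ, real_inner_comm (Y x)]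

theorem η_cov_ξ (x : M) (v : TangentSpace (𝓡 n) x) [T2Space M] : A.η x (D A.ξ x v) = 0 := by
  have h := A.deriv_η hD A.smooth_ξ (extField v) x
  have e : (fun y => A.η y (A.ξ y)) = fun _ => 1 := funext A.η_ξ
  rw [e, dirDeriv, mvfderiv_const, A.inner_ξ, extField_self] at h
  simp only [_root_.zero_apply] at h
  linarith

variable [T2Space M]

/-- The derivative of the skew symmetry of `φ`. -/
theorem covφ_skew (x : M) (u v w : TangentSpace (𝓡 n) x) :
    ⟪A.covφ D x u v, w⟫ = -⟪v, A.covφ D x u w⟫ := by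
  have hY := isSmoothField_extField v
  have hZ := isSmoothField_extField w
  have h1 := hD.deriv_inner (hY.φField (A := A)) hZ (extField u) x
  have h2 := hD.deriv_inner hY (hZ.φField (A := A)) (extField u) x
  have e : (fun y => ⟪A.φField (extField v) y, extField w y⟫)
      = -fun y => ⟪extField v y, A.φField (extField w) y⟫ :=
    funext fun y => by
      simp only [Pi.neg_apply, φField_apply, A.skew, neg_neg]
  rw [e, dirDeriv, mvfderiv_neg, _root_.neg_apply, ← dirDeriv, h2] at h1
  simp only [A.cov_φField D hY, A.cov_φField D hZ, φField_apply, extField_self, inner_add_left,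
    inner_add_right, A.skew] at h1
  linarith

/-- The derivative of `φ² = -1 + η ⊗ ξ`. -/
theorem covφ_φ (x : M) (u v : TangentSpace (𝓡 n) x) :
    A.covφ D x u (A.φ x v) + A.φ x (A.covφ D x u v)
      = ⟪D A.ξ x u, v⟫ • A.ξ x + A.η x v • D A.ξ x u := by
  have hY := isSmoothField_extField v
  have hη : ContMDiff (𝓡 n) 𝓘(ℝ, ℝ) ∞ (fun y => A.η y (extField v y)) := A.smooth_η _ hY
  have e : A.φField (A.φField (extField v)) = -extField v + (fun y => A.η y (extField v y)) • A.ξ :=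
    funext fun y => A.φ_φ y _
  have h := A.covφ_apply D (hY.φField (A := A)) x u
  have h2 := A.deriv_η hD hY (extField u) x
  rw [e, cov_add D x hY.neg (A.smooth_ξ.smul hη), cov_neg D x hY, _root_.add_apply,
    cov_smul D x hη A.smooth_ξ, A.cov_φField D hY] at h
  simp only [dirDeriv, extField_self] at h2
  simp only [φField_apply, extField_self, map_add, A.φ_φ, _root_.neg_apply, h2] at h
  rw [h]
  module

end Metric

section LeviCivita

variable {A} [T2Space M] {D : LinearConnection n M} (hD : IsLeviCivita D) {α : ℝ}
  (hA : A.IsAlphaCosymplectic α)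
include hD hA

/-- The condition `dη = 0`, for a torsion free metric connection. -/
theorem cov_ξ_symm (x : M) (u v : TangentSpace (𝓡 n) x) :
    ⟪D A.ξ x u, v⟫ = ⟪D A.ξ x v, u⟫ := by
  have hX := isSmoothField_extField u
  have hY := isSmoothField_extField v
  have h := hA.d_η _ _ hX hY x
  rw [extDerivOne, A.deriv_η hD.metric hX, A.deriv_η hD.metric hY, hD.mlieBracket_eq hX hY,
    map_sub] at h
  simp only [extField_self] at h
  linarith

/-- The condition `dΦ = 2α η ∧ Φ`, for a torsion free metric connection. -/
theorem covφ_cyclic (x : M) (u v w : TangentSpace (𝓡 n) x) :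
    ⟪A.covφ D x u v, w⟫ + ⟪A.covφ D x v w, u⟫ + ⟪A.covφ D x w u, v⟫
      = 2 * α * (A.η x u * ⟪A.φ x v, w⟫ + A.η x v * ⟪A.φ x w, u⟫ + A.η x w * ⟪A.φ x u, v⟫) := by
  have hX := isSmoothField_extField u
  have hY := isSmoothField_extField v
  have hZ := isSmoothField_extField w
  have h := hA.d_Φ _ _ _ hX hY hZ x
  have a {X Y Z : VField n M} (hX : IsSmoothField X) (hY : IsSmoothField Y)
      (hZ : IsSmoothField Z) : dirDeriv X (fun y => ⟪A.φ y (Y y), Z y⟫) x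
      = ⟪A.covφ D x (X x) (Y x), Z x⟫ + ⟪A.φ x (D Y x (X x)), Z x⟫
        - ⟪A.φ x (D Z x (X x)), Y x⟫ := by
    have h := hD.metric.deriv_inner (hY.φField (A := A)) hZ X x
    rw [A.cov_φField D hY, inner_add_left, φField_apply, ← real_inner_comm (A.φ x (Y x)),
      A.skew] at h
    rw [sub_eq_add_neg]
    exact h
  simp only [extDerivTwo, wedgeOneTwo, Phi, a hX hY hZ, a hY hZ hX, a hZ hX hY,
    hD.mlieBracket_eq hX hY,
    hD.mlieBracket_eq hY hZ, hD.mlieBracket_eq hZ hX, map_sub, inner_sub_left, extField_self] at h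
  linarith

/-- Normality, for a torsion free metric connection and closed `η`. -/
theorem covφ_nijenhuis (x : M) (u v : TangentSpace (𝓡 n) x) :
    A.covφ D x (A.φ x u) v - A.covφ D x (A.φ x v) u + A.φ x (A.covφ D x v u)
      - A.φ x (A.covφ D x u v) = 0 := by
  have hX := isSmoothField_extField u
  have hY := isSmoothField_extField v
  have h := hA.normal _ _ hX hY x
  have hX' := hX.φField (A := A)
  have hY' := hY.φField (A := A)
  rw [nijenhuis, hA.d_η _ _ hX hY] at h
  change mlieBracket (𝓡 n) (A.φField (extField u)) (A.φField (extField v)) x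
    - A.φ x (mlieBracket (𝓡 n) (A.φField (extField u)) (extField v) x)
    - A.φ x (mlieBracket (𝓡 n) (extField u) (A.φField (extField v)) x) + _ + _ = 0 at h
  simp only [hD.mlieBracket_eq hX hY, hD.mlieBracket_eq hX' hY, hD.mlieBracket_eq hX hY',
    hD.mlieBracket_eq hX' hY',
    A.cov_φField D hX, A.cov_φField D hY, map_sub, map_add, φField_apply,
    extField_self, zero_smul] at h
  rw [← h]
  abel

/-- The structure equations `∇_X ξ = α (X - η(X) ξ)` and
`(∇_X φ) Y = α (⟪φ X, Y⟫ ξ - η(Y) φ X)` of an `α`-cosymplectic manifold. -/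
theorem nabla_formulas (x : M) :
    (∀ u, D A.ξ x u = α • (u - A.η x u • A.ξ x)) ∧
      ∀ u v, A.covφ D x u v = α • (⟪A.φ x u, v⟫ • A.ξ x - A.η x v • A.φ x u) :=
  (A.contactAlgebra x).nabla_formulas (P := A.covφ D x)
    (h := (D A.ξ x : TangentSpace (𝓡 n) x →ₗ[ℝ] TangentSpace (𝓡 n) x))
    (A.covφ_skew hD.metric x) (A.covφ_φ hD.metric x) (A.covφ_ξ D x)
    (cov_ξ_symm hD hA x) (fun u => A.η_cov_ξ hD.metric x u) (covφ_cyclic hD hA x)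
    (covφ_nijenhuis hD hA x)

end LeviCivita

end AlmostContactMetric

end

/-! ### Curvature and `∗`-scalar curvature -/

section

variable {n : ℕ} {M : Type*} [TopologicalSpace M] [T2Space M]
  [ChartedSpace (EuclideanSpace ℝ (Fin n)) M]
  [IsManifold (𝓡 n) ∞ M] [RiemannianBundle (fun x : M => TangentSpace (𝓡 n) x)]
  [IsContMDiffRiemannianBundle (𝓡 n) ∞ (EuclideanSpace ℝ (Fin n))
    (fun x : M => TangentSpace (𝓡 n) x)]

namespace AlmostContactMetric

variable {A : AlmostContactMetric n M}

section LeviCivita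

variable {D : LinearConnection n M} (hD : IsLeviCivita D) {α : ℝ}
  (hA : A.IsAlphaCosymplectic α)
include hD hA

/-- The second covariant derivative of `φ Z`, from differentiating the field equation
`∇_Y (φ Z) = φ ∇_Y Z + α (⟪φ Y, Z⟫ ξ - η(Z) φ Y)`. -/
theorem cov_cov_φField (X : VField n M) {Y Z : VField n M} (hY : IsSmoothField Y)
    (hZ : IsSmoothField Z) (x : M) :
    D (cov D Y (A.φField Z)) x (X x)
      = A.φ x (D (cov D Y Z) x (X x))
        + α • (⟪A.φ x (X x), D Z x (Y x)⟫ • A.ξ x - A.η x (D Z x (Y x)) • A.φ x (X x))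
        + α • (⟪A.φ x (Y x), D Z x (X x)⟫ • A.ξ x - A.η x (D Z x (X x)) • A.φ x (Y x))
        + α • (⟪A.φ x (D Y x (X x)), Z x⟫ • A.ξ x - A.η x (Z x) • A.φ x (D Y x (X x)))
        + α ^ 2 • (⟪A.φ x (Y x), Z x⟫ • X x - (A.η x (Y x) * ⟪A.φ x (X x), Z x⟫) • A.ξ x
          - (A.η x (X x) * ⟪A.φ x (Y x), Z x⟫) • A.ξ x - ⟪X x, Z x⟫ • A.φ x (Y x)
          + (A.η x (X x) * A.η x (Z x)) • A.φ x (Y x)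
          + (A.η x (Y x) * A.η x (Z x)) • A.φ x (X x)) := by
  have hφY := hY.φField (A := A)
  have hP x := (nabla_formulas hD hA x).2
  have hh x := (nabla_formulas hD hA x).1
  have hf : ContMDiff (𝓡 n) 𝓘(ℝ, ℝ) ∞ (fun y => ⟪A.φField Y y, Z y⟫) := hφY.inner hZ
  have hη : ContMDiff (𝓡 n) 𝓘(ℝ, ℝ) ∞ (fun y => A.η y (Z y)) := A.smooth_η Z hZ
  have e : cov D Y (A.φField Z) = A.φField (cov D Y Z)
      + α • ((fun y => ⟪A.φField Y y, Z y⟫) • A.ξ - (fun y => A.η y (Z y)) • A.φField Y) := by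
    funext y
    rw [cov, A.cov_φField D hZ, hP, add_comm]
    rfl
  have h1 := hD.metric.deriv_inner hφY hZ X x
  have h2 := A.deriv_η hD.metric hZ X x
  simp only [dirDeriv, A.cov_φField D hY, hP, hh] at h1 h2
  have s1 := A.smooth_ξ.smul hf
  have s2 := hφY.smul hη
  have c : cov D Y Z x = D Z x (Y x) := rfl
  rw [e, cov_add D x (hD.smooth _ _ hY hZ).φField ((s1.sub s2).const_smul α),
    cov_const_smul D x α (s1.sub s2), cov_sub D x s1 s2, _root_.add_apply, _root_.smul_apply,
    _root_.sub_apply, cov_smul D x hf A.smooth_ξ, cov_smul D x hη hφY, h1, h2,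
    A.cov_φField D (hD.smooth _ _ hY hZ), A.cov_φField D hY, hP, hP, hh, c]
  simp only [φField_apply, inner_add_left, inner_sub_left, inner_smul_left, conj_trivial,
    real_inner_comm (Z x) (A.ξ x), A.inner_ξ]
  module

/-- The commutation rule of the curvature and `φ`, by antisymmetrizing `cov_cov_φField`. -/
theorem curvatureTensor_φ (x : M) (u v w : TangentSpace (𝓡 n) x) :
    curvatureTensor hD.isSmoothConnection x u v (A.φ x w)
      = A.φ x (curvatureTensor hD.isSmoothConnection x u v w)
        + α ^ 2 • (⟪A.φ x v, w⟫ • u - ⟪A.φ x u, w⟫ • v - ⟪u, w⟫ • A.φ x v + ⟪v, w⟫ • A.φ x u) := by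
  have hX := isSmoothField_extField u
  have hY := isSmoothField_extField v
  have hZ := isSmoothField_extField w
  have h1 := curvatureTensor_apply hD.isSmoothConnection hX hY (hZ.φField (A := A)) x
  have h2 := curvatureTensor_apply hD.isSmoothConnection hX hY hZ x
  have hP := (nabla_formulas hD hA x).2
  rw [curvField_apply, cov_cov_φField hD hA _ hY hZ, cov_cov_φField hD hA _ hX hZ,
    A.cov_φField D hZ, hP, hD.mlieBracket_eq hX hY] at h1
  rw [curvField_apply, hD.mlieBracket_eq hX hY] at h2
  simp only [extField_self, φField_apply] at h1 h2
  rw [h1, h2]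
  simp only [map_sub, inner_sub_left]
  module

/-- The Levi-Civita connection has `∗`-scalar curvature `r + α² (n - 1)²`. -/
theorem starScalarCurv_leviCivita (x : M) :
    starScalarCurv D A.φ x = scalarCurv D x + α ^ 2 * ((n : ℝ) - 1) ^ 2 := by
  have h := (A.contactAlgebra x).star_scalar_eq (onb x) (hD.curvatureLike (A := A) x)
    (curvatureTensor_φ hD hA x)
  have hn : Module.finrank ℝ (TangentSpace (𝓡 n) x) = n := finrank_euclideanSpace_fin
  rw [Fintype.card_fin] at h
  simp only [starScalarCurv, starRicci, scalarCurv, ricci, metricTrace,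
    curv_eq_curvatureTensor hD.isSmoothConnection]
  refine h.trans ?_
  simp only [hn]

end LeviCivita

section QuarterSymmetric

variable {D nabla : LinearConnection n M} (hD : A.IsQuarterSymmetricMetric D)
  (hn : IsLeviCivita nabla)
include hD hn

/-- The quarter-symmetric metric connection is `∇ - η ⊗ φ`. -/
theorem quarterSymmetric_eq {Y : VField n M} (hY : IsSmoothField Y) (x : M)
    (v : TangentSpace (𝓡 n) x) :
    D Y x v = nabla Y x v - A.η x v • A.φ x (Y x) := by
  have hd {Z : VField n M} (hZ : IsSmoothField Z) : D.difference nabla x (Z x) = D Z x - nabla Z x :=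
    IsCovariantDerivativeOn.difference_apply _ _ (Set.mem_univ x) (hZ.mdiffAt x)
  have hd' (v y : TangentSpace (𝓡 n) x) :
      D.difference nabla x y v = D (extField y) x v - nabla (extField y) x v := by
    rw [← _root_.sub_apply, ← hd (isSmoothField_extField y), extField_self]
  have h := (A.contactAlgebra x).eq_neg_smul_of_skew
    (H := fun v y => D.difference nabla x y v) ?_ ?_ v (Y x)
  · rw [hd hY, _root_.sub_apply, sub_eq_iff_eq_add'] at h
    rw [h, sub_eq_add_neg]
    rfl
  · intro v y z
    have hy := isSmoothField_extField y
    have hz := isSmoothField_extField z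
    have h1 := hD.metric.deriv_inner hy hz (extField v) x
    have h2 := hn.metric.deriv_inner hy hz (extField v) x
    simp only [extField_self] at h1 h2
    simp only [hd', inner_sub_left, inner_sub_right]
    linarith
  · intro v y
    have hv := isSmoothField_extField v
    have hy := isSmoothField_extField y
    have h1 := D.torsion_apply (hv.mdiffAt x) (hy.mdiffAt x)
    have h2 := hn.mlieBracket_eq hv hy x
    rw [hD.torsion_eq, h2] at h1
    simp only [extField_self] at h1
    simp only [hd', ContinuousLinearMap.coe_coe]
    rw [h1]
    abel

/-- The curvature of `∇ - η ⊗ φ`; the term `dη(X, Y) φ Z` is absent because `η` is closed. -/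
theorem curvField_quarterSymmetric {α : ℝ} (hA : A.IsAlphaCosymplectic α) {X Y Z : VField n M}
    (hX : IsSmoothField X) (hY : IsSmoothField Y) (hZ : IsSmoothField Z) (x : M) :
    curvField D X Y Z x = curvField nabla X Y Z x
      + A.η x (X x) • A.covφ nabla x (Y x) (Z x) - A.η x (Y x) • A.covφ nabla x (X x) (Z x) := by
  have hφZ := hZ.φField (A := A)
  have a {X Y : VField n M} (hX : IsSmoothField X) (hY : IsSmoothField Y) :
      D (cov D Y Z) x (X x) = nabla (cov nabla Y Z) x (X x)
        - (A.η x (Y x) • (A.covφ nabla x (X x) (Z x) + A.φ x (nabla Z x (X x)))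
          + dirDeriv X (fun y => A.η y (Y y)) x • A.φ x (Z x))
        - A.η x (X x) • A.φ x (nabla Z x (Y x) - A.η x (Y x) • A.φ x (Z x)) := by
    have e : cov D Y Z = cov nabla Y Z - (fun y => A.η y (Y y)) • A.φField Z :=
      funext fun y => quarterSymmetric_eq hD hn hZ y (Y y)
    have hη := A.smooth_η Y hY
    have s := hφZ.smul hη
    rw [quarterSymmetric_eq hD hn (hD.smooth _ _ hY hZ), e,
      cov_sub nabla x (hn.smooth _ _ hY hZ) s, _root_.sub_apply, cov_smul nabla x hη hφZ,
      A.cov_φField nabla hZ]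
    rfl
  have h := hA.d_η _ _ hX hY x
  rw [extDerivOne] at h
  have h' : A.η x (mlieBracket (𝓡 n) X Y x) = dirDeriv X (fun y => A.η y (Y y)) x
      - dirDeriv Y (fun y => A.η y (X y)) x := by linarith
  rw [curvField_apply, a hX hY, a hY hX, quarterSymmetric_eq hD hn hZ, h', curvField_apply]
  simp only [map_sub, map_smul]
  module

/-- The `∗`-Ricci tensors of the quarter-symmetric metric connection and of the Levi-Civita
connection agree: the extra term `η(Y) (∇_{φ Z} φ) φ X` is a multiple of `ξ` and linear in `φ X`,
so it has trace zero. -/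
theorem starRicci_quarterSymmetric {α : ℝ} (hA : A.IsAlphaCosymplectic α) (x : M)
    (v w : TangentSpace (𝓡 n) x) : starRicci D A.φ x v w = starRicci nabla A.φ x v w := by
  have hP := (nabla_formulas hn hA x).2
  have h (a : TangentSpace (𝓡 n) x) : ⟪curv D x v (A.φ x w) (A.φ x a), a⟫
      = ⟪curv nabla x v (A.φ x w) (A.φ x a), a⟫
        - (A.η x v * α) * (⟪A.φ x (A.φ x (A.φ x w)), a⟫ * ⟪A.ξ x, a⟫) := by
    rw [curv_eq_extField hD.smooth, curv_eq_extField hn.smooth,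
      curvField_quarterSymmetric hD hn hA (isSmoothField_extField _) (isSmoothField_extField _)
        (isSmoothField_extField _)]
    simp only [extField_self, hP, A.η_φ, inner_add_left, inner_sub_left, inner_smul_left,
      conj_trivial, A.skew x (A.φ x (A.φ x w))]
    ring
  simp only [starRicci, metricTrace, h, Finset.sum_sub_distrib, ← Finset.mul_sum,
    ContactAlgebra.sum_inner_mul_inner, A.inner_ξ, A.η_φ]
  ring

end QuarterSymmetric

end AlmostContactMetric

end

end StarYamabe

end

theorem theorem5p2 (n : ℕ) (M : Type*) [TopologicalSpace M] [T2Space M]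
    [ChartedSpace (EuclideanSpace ℝ (Fin n)) M] [IsManifold (𝓡 n) ∞ M]
    [RiemannianBundle (fun x : M => TangentSpace (𝓡 n) x)]
    [IsContMDiffRiemannianBundle (𝓡 n) ∞ (EuclideanSpace ℝ (Fin n))
      (fun x : M => TangentSpace (𝓡 n) x)]
    (A : StarYamabe.AlmostContactMetric n M) (α : ℝ) (hA : A.IsAlphaCosymplectic α)
    (nabla : StarYamabe.LinearConnection n M) (h_nabla : StarYamabe.IsLeviCivita nabla)
    (D : StarYamabe.LinearConnection n M) (hD : A.IsQuarterSymmetricMetric D)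
    (Λ μ : ℝ) (hsol : A.IsStarEtaYamabeSoliton D Λ μ)
    (f : M → ℝ) (hf : ContMDiff (𝓡 n) 𝓘(ℝ, ℝ) ∞ f)
    (hξ : A.ξ = StarYamabe.grad f) (x : M) :
    StarYamabe.laplacian nabla f x
      = -(n : ℝ) * (Λ - StarYamabe.scalarCurv nabla x / 2 - α ^ 2 * ((n : ℝ) - 1) ^ 2 / 2)
        - μ := by
  have hr : StarYamabe.starScalarCurv D A.φ x =
      StarYamabe.scalarCurv nabla x + α ^ 2 * ((n : ℝ) - 1) ^ 2 := by
    rw [← StarYamabe.AlmostContactMetric.starScalarCurv_leviCivita h_nabla hA]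
    simp only [StarYamabe.starScalarCurv, StarYamabe.metricTrace,
      StarYamabe.AlmostContactMetric.starRicci_quarterSymmetric hD h_nabla hA]
  have hn : Module.finrank ℝ (TangentSpace (𝓡 n) x) = n := finrank_euclideanSpace_fin
  have h1 : ∑ i, inner ℝ (StarYamabe.onb (n := n) x i) (StarYamabe.onb (n := n) x i) = (n : ℝ) := by
    simp [hn]
  have h2 : ∑ i, A.η x (StarYamabe.onb (n := n) x i) * A.η x (StarYamabe.onb (n := n) x i) = 1 := by
    simp only [← A.inner_ξ]
    rw [← A.η_ξ x, ← A.inner_ξ, ← (StarYamabe.onb (n := n) x).sum_inner_mul_inner]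
    simp only [real_inner_comm]
  have h3 (v : TangentSpace (𝓡 n) x) : D A.ξ x v = nabla A.ξ x v := by
    rw [StarYamabe.AlmostContactMetric.quarterSymmetric_eq hD h_nabla A.smooth_ξ, A.φ_ξ, smul_zero,
      sub_zero]
  have h5 (v : TangentSpace (𝓡 n) x) :
      inner ℝ v (nabla A.ξ x v) = inner ℝ (nabla A.ξ x v) v := real_inner_comm _ _
  -- Trace of the soliton equation.
  have h4 := Finset.sum_eq_zero fun i (_ : i ∈ Finset.univ) =>
    hsol x (StarYamabe.onb (n := n) x i) (StarYamabe.onb (n := n) x i)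
  simp only [StarYamabe.lieMetric, h3, hr, Finset.sum_add_distrib, ← Finset.mul_sum, h1, h2,
    h5] at h4
  rw [StarYamabe.laplacian, ← hξ, StarYamabe.divergence, StarYamabe.metricTrace]
  linarith
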